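/- Let $(T_n)_{n\ge 1}$ be the uniform random recursive tree: $T_1$ is the single vertex $1$ (the root), and $T_{n+1}$ is obtained from $T_n$ by adding the vertex $n+1$ and joining it to a vertex chosen uniformly at random from $[n]=\{1,\dots,n\}$, independently of the past. For a tree $T$ and a vertex $v$ of $T$, the betweenness centrality $\mathcal B_T(v)$ is the number of ordered pairs $(s,t)$ of vertices different from $v$ such that the path in $T$ between $s$ and $t$ passes through $v$. Rank the vertices of $T_n$ by decreasing betweenness, a vertex with larger label coming first among vertices of equal betweenness, and let $R_n\in[n]$ be the rank of the root. For a real number $K>0$ let $H_K=H_K(T_n)$ be the set of vertices of $T_n$ of rank at most $K$. Then: 1. There is a constant $c>0$ such that for all $n\ge 1$ and all $x\in[n]$, $\mathbb P(R_n>x)\le c/x$. 2. The sequence $(R_n)$ is tight: for every $\varepsilon>0$ there is a positive integer $K$ such that $\mathbb P(R_n\le K)\ge 1-\varepsilon$ for all $n\ge 1$. 3. There is a constant $C>0$ such that for every $\varepsilon>0$, with $K=C/\varepsilon$, $\liminf_{n\to\infty}\mathbb P(1\in H_K(T_n))\ge 1-\varepsilon$. 4. $\mathbb E R_n=\Theta(\log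 n)$ as $n\to\infty$ (in particular the expectation exists for every $n$). 5. For every $n\ge 2$ the root is a leaf of $T_n$ with probability $1/(n-1)$, and whenever it is a leaf, $R_n=n$. -/

import Mathlib

open MeasureTheory ProbabilityTheory Filter Topology Asymptotics

/-! ### Centrality on a finite tree -/

/-- Betweenness centrality of `v` in a tree `T`: the number of ordered pairs `(s, t)` of vertices,
both different from `v`, such that the path between `s` and `t` passes through `v`.
(In a tree there is exactly one path between `s` and `t`.) -/
noncomputable def betweenness {V : Type*} (T : SimpleGraph V) (v : V) : ℕ :=
  {p : V × V | p.1 ≠ v ∧ p.2 ≠ v ∧ ∃ w : T.Walk p.1 p.2, w.IsPath ∧ v ∈ w.support}.ncard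

/-- For a score `ψ` whose larger values are more central: `v` is ranked before `u`. Ties are broken
pessimistically, i.e. among vertices of equal score the later vertex comes first. -/
def RankedBefore {n : ℕ} (ψ : Fin n → ℕ) (v u : Fin n) : Prop :=
  ψ u < ψ v ∨ (ψ v = ψ u ∧ u < v)

/-- The rank of `u`: one plus the number of vertices that are ranked before `u`. -/
noncomputable def centralityRank {n : ℕ} (ψ : Fin n → ℕ) (u : Fin n) : ℕ :=
  1 + {v : Fin n | RankedBefore ψ v u}.ncard

/-! ### The uniform random recursive tree

The vertex with label `i ∈ {1, …, n}` is the element `i - 1` of `Fin n`; the root, with label `1`,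
is `0`. -/

/-- The sequence of attachment choices: `ω k` is the vertex (one of `0, …, k`) to which
the vertex `k + 1` is attached. -/
abbrev Attachments : Type := (k : ℕ) → Fin (k + 1)

/-- The attachment choices are independent, and `ω k` is uniform on the `k + 1` vertices
already present. -/
noncomputable def urrtMeasure : Measure Attachments :=
  Measure.infinitePi fun k : ℕ => (PMF.uniformOfFintype (Fin (k + 1))).toMeasure

/-- The tree `T_n` on `n` vertices: each vertex `k + 1 < n` is joined to `ω k`. -/
def urrt (ω : Attachments) (n : ℕ) : SimpleGraph (Fin n) :=
  SimpleGraph.fromRel fun u v => ∃ k : ℕ, (v : ℕ) = k + 1 ∧ (u : ℕ) = ω k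

theorem urrt_adj_attachment (ω : Attachments) (n k : ℕ) (hk : k + 1 < n) :
    (urrt ω n).Adj ⟨ω k, lt_trans (ω k).isLt hk⟩ ⟨k + 1, hk⟩ := by
  refine (SimpleGraph.fromRel_adj _ _ _).2 ⟨?_, Or.inl ⟨k, rfl, rfl⟩⟩
  intro h
  have h1 : ((ω k : Fin (k + 1)) : ℕ) = k + 1 := congrArg Fin.val h
  have h2 := (ω k).isLt
  omega

/-- `T_n` is a tree for `n ≥ 1`. -/
theorem urrt_isTree (ω : Attachments) (n : ℕ) (hn : 0 < n) : (urrt ω n).IsTree := by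
  have hreach : ∀ i : ℕ, ∀ hi : i < n, (urrt ω n).Reachable ⟨0, hn⟩ ⟨i, hi⟩ := by
    intro i
    induction i using Nat.strong_induction_on with
    | _ i ih =>
      intro hi
      rcases i with _ | k
      · exact SimpleGraph.Reachable.refl _
      · exact (ih _ (ω k).isLt (lt_trans (ω k).isLt hi)).trans
          (urrt_adj_attachment ω n k hi).reachable
  have hconn : (urrt ω n).Connected :=
    { preconnected := fun u v => (hreach u u.isLt).symm.trans (hreach v v.isLt)
      nonempty := ⟨⟨0, hn⟩⟩ }
  refine SimpleGraph.isTree_iff_connected_and_card.2 ⟨hconn, ?_⟩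
  refine le_antisymm ?_ hconn.card_vert_le_card_edgeSet_add_one
  have hsub : (urrt ω n).edgeSet ⊆ Set.range fun k : Fin (n - 1) =>
      s((⟨ω k, by have := (ω k).isLt; omega⟩ : Fin n), (⟨k + 1, by omega⟩ : Fin n)) := by
    intro e
    induction e using Sym2.ind with
    | _ u v =>
      intro he
      have hadj : (urrt ω n).Adj u v := he
      rcases ((SimpleGraph.fromRel_adj _ _ _).1 hadj).2 with ⟨k, hv, hu⟩ | ⟨k, hv, hu⟩
      · refine ⟨⟨k, by omega⟩, ?_⟩
        have e1 : u = ⟨ω k, by omega⟩ := Fin.ext hu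
        have e2 : v = ⟨k + 1, by omega⟩ := Fin.ext hv
        exact congrArg₂ (fun a b => s(a, b)) e1.symm e2.symm
      · refine ⟨⟨k, by omega⟩, ?_⟩
        have e1 : v = ⟨ω k, by omega⟩ := Fin.ext hu
        have e2 : u = ⟨k + 1, by omega⟩ := Fin.ext hv
        exact Sym2.eq_swap.trans (congrArg₂ (fun a b => s(a, b)) e2.symm e1.symm)
  have h1 := Nat.card_mono (Set.finite_range _) hsub
  have h2 := Finite.card_range_le fun k : Fin (n - 1) =>
      s((⟨ω k, by have := (ω k).isLt; omega⟩ : Fin n), (⟨k + 1, by omega⟩ : Fin n))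
  have h3 := h1.trans h2
  simp only [Nat.card_eq_fintype_card (α := Fin _), Fintype.card_fin] at h3 ⊢
  omega

/-- The betweenness rank of a vertex of `T_n`. -/
noncomputable def betweennessRank (ω : Attachments) (n : ℕ) (v : Fin n) : ℕ :=
  centralityRank (betweenness (urrt ω n)) v

/-- `R_n`, the betweenness rank of the root of `T_n` (with the dummy value `0` for `n = 0`,
where there is no tree). -/
noncomputable def rootRank (n : ℕ) (ω : Attachments) : ℕ :=
  if hn : 0 < n then betweennessRank ω n ⟨0, hn⟩ else 0

/-- `H_K`, the set of the top `K` most central vertices of `T_n` (the top `⌊K⌋` if the real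
number `K` is not an integer). -/
def topVertices (ω : Attachments) (n : ℕ) (K : ℝ) : Set (Fin n) :=
  {v | (betweennessRank ω n v : ℝ) ≤ K}

/-- The event that the root of `T_n` belongs to `H_K`. -/
def rootInTop (n : ℕ) (K : ℝ) : Set Attachments :=
  {ω | ∃ hn : 0 < n, (⟨0, hn⟩ : Fin n) ∈ topVertices ω n K}

/-- The root of `T_n` is a leaf, i.e. it has exactly one neighbour. -/
def RootIsLeaf (n : ℕ) (ω : Attachments) : Prop :=
  ∃ hn : 0 < n, ((urrt ω n).neighborSet ⟨0, hn⟩).ncard = 1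

/-! ### Expectations of functions of finitely many attachment choices -/

/-! Vertex `1` is always a child of the root `0`. Removing the edge between them leaves parts of
sizes `a` (descendants of `1`) and `c`, which evolve as a Pólya urn, so each is uniform on `{1, …, n
- 1}` (`Inherited.integral_comp_countBelow`). The root is a leaf iff `c = 1`, which has probability
`1 / (n - 1)`, and then its betweenness is zero.

Tail: pairs separated by the root give it betweenness at least `2a(c - 1)`, while a vertex `j` with
`s` descendants has at most `(n - 1)² - (n - s)²`. So `j` can precede the root only if `min(a, c) ≤
3s` (`BeatsRoot.one_le`). For `x` either of `a`, `c`, once `x ≥ 3`, the mean of `1 / ((x - 1)(x -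
2))` decays quadratically in time, and from the birth of `j` on `s(s + 1) / ((x - 1)(x - 2))` is a
supermartingale (`Inherited.integral_descendants_mul_invSq_le`). Summing over `j > q`, boundedly
many late vertices precede the root in expectation, on the event that both parts have at least three
of the first `q + 1` vertices. This event fails with probability `O(1/q)`, and Markov's inequality
at level `q + 1` gives `P(R_n > 2(q + 1)) = O(1/q)`. Tightness, the confidence set and the
logarithmic upper bound follow.

Lower bound: with probability `1/j` the root is a leaf among the first `j + 1` vertices. Then the
root's part and the progeny of `j` both start from one vertex and are exchangeable, so with
conditional probability at least `1/3` the progeny is at least about twice as large as the root's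
part. Unless it exceeds half of the tree, which a first moment bound makes unlikely, `j` precedes
the root. Hence `j` does so with probability at least `1 / (12j)` for `j ≥ 7`, and these sum to
order `log n`. -/

instance : IsProbabilityMeasure urrtMeasure := by
  unfold urrtMeasure; infer_instance

/-- Everything about `T_n` is a function on a finite product of finite sets; measurability and
integrability are then automatic. -/
theorem DependsOn.exists_eq_comp_restrict {β : Type*} [Nonempty β] {k : ℕ}
    {F : Attachments → β} (hF : DependsOn F (Set.Iio k)) :
    ∃ g : ((i : Finset.range k) → Fin (i + 1)) → β, F = fun ω => g fun i => ω i := by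
  have h : DependsOn F ((Finset.range k : Finset ℕ) : Set ℕ) := by simpa using hF
  obtain ⟨g, hg⟩ := dependsOn_iff_exists_comp.1 h
  exact ⟨g, hg⟩

theorem DependsOn.measurable_attachments {β : Type*} [Nonempty β] [MeasurableSpace β] {k : ℕ}
    {F : Attachments → β} (hF : DependsOn F (Set.Iio k)) : Measurable F := by
  obtain ⟨g, rfl⟩ := hF.exists_eq_comp_restrict
  exact (measurable_of_countable g).comp (measurable_pi_lambda _ fun i => measurable_pi_apply _)

theorem DependsOn.integrable_attachments {k : ℕ} {F : Attachments → ℝ}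
    (hF : DependsOn F (Set.Iio k)) : Integrable F urrtMeasure := by
  have hm := hF.measurable_attachments
  obtain ⟨g, rfl⟩ := hF.exists_eq_comp_restrict
  obtain ⟨C, hC⟩ := (Set.finite_range fun x => ‖g x‖).bddAbove
  exact Integrable.of_bound hm.aestronglyMeasurable C
    (ae_of_all _ fun ω => hC ⟨_, rfl⟩)

theorem DependsOn.measurableSet_attachments {k : ℕ} {E : Attachments → Prop}
    (hE : DependsOn E (Set.Iio k)) : MeasurableSet {ω | E ω} :=
  measurableSet_setOfPred.2 hE.measurable_attachments

theorem dependsOn_update {k : ℕ} {G : Attachments → ℝ} (hG : DependsOn G (Set.Iio (k + 1)))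
    (i : Fin (k + 1)) : DependsOn (fun ω => G (Function.update ω k i)) (Set.Iio k) := by
  intro ω ω' h
  refine hG fun j hj => ?_
  rcases eq_or_ne j k with rfl | hne
  · simp
  · rw [Function.update_of_ne hne, Function.update_of_ne hne]
    exact h j (lt_of_le_of_ne (Nat.lt_succ_iff.1 hj) hne)

theorem integral_indicator_coord_mul {k : ℕ} {H : Attachments → ℝ}
    (hH : DependsOn H (Set.Iio k)) (i : Fin (k + 1)) :
    ∫ ω, (if ω k = i then (1 : ℝ) else 0) * H ω ∂urrtMeasure
      = (∫ ω, H ω ∂urrtMeasure) / (k + 1) := by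
  have hind : iIndepFun (fun (j : ℕ) (ω : Attachments) => ω j) urrtMeasure :=
    iIndepFun_infinitePi (P := fun k : ℕ => (PMF.uniformOfFintype (Fin (k + 1))).toMeasure)
      (X := fun _ x => x) fun _ => measurable_id
  have h2 := hind.indepFun_finset {k} (Finset.range k) (by simp) fun j => measurable_pi_apply j
  obtain ⟨g, rfl⟩ := hH.exists_eq_comp_restrict
  have h3 := h2.comp
    (φ := fun x => if x ⟨k, Finset.mem_singleton_self k⟩ = i then (1 : ℝ) else 0) (ψ := g)
    (measurable_of_countable _) (measurable_of_countable _)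
  have hdep : DependsOn (fun ω : Attachments => if ω k = i then (1 : ℝ) else 0)
      (Set.Iio (k + 1)) := by
    intro ω ω' h
    have := h k (Set.mem_Iio.2 (Nat.lt_succ_self k))
    simp only [this]
  have h4 := h3.integral_fun_mul_eq_mul_integral hdep.measurable_attachments.aestronglyMeasurable
    hH.measurable_attachments.aestronglyMeasurable
  have h5 : ∫ ω, (if ω k = i then (1 : ℝ) else 0) ∂urrtMeasure = 1 / (k + 1) := by
    have e : (fun ω : Attachments => if ω k = i then (1 : ℝ) else 0)
        = Set.indicator ((fun ω : Attachments => ω k) ⁻¹' {i}) 1 := by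
      funext ω
      by_cases h : ω k = i <;> simp [h]
    rw [e, integral_indicator_one (measurable_pi_apply k (measurableSet_singleton i))]
    have hmp := measurePreserving_eval_infinitePi
      (fun k : ℕ => (PMF.uniformOfFintype (Fin (k + 1))).toMeasure) k
    have := hmp.measure_preimage (measurableSet_singleton i).nullMeasurableSet
    rw [measureReal_def]
    change (Measure.infinitePi (fun k : ℕ => (PMF.uniformOfFintype (Fin (k + 1))).toMeasure)
      (Function.eval k ⁻¹' {i})).toReal = _
    rw [this, PMF.toMeasure_apply_singleton _ _ (measurableSet_singleton i)]
    simp [PMF.uniformOfFintype_apply, ENNReal.toReal_inv]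
    norm_cast
  refine h4.trans ?_
  change (∫ ω : Attachments, (if ω k = i then (1 : ℝ) else 0) ∂urrtMeasure) * _ = _
  rw [h5, one_div, inv_mul_eq_div]
  rfl

/-- The last of finitely many attachment choices may be averaged out. -/
theorem integral_eq_integral_average {k : ℕ} {G : Attachments → ℝ}
    (hG : DependsOn G (Set.Iio (k + 1))) :
    ∫ ω, G ω ∂urrtMeasure
      = ∫ ω, (∑ i : Fin (k + 1), G (Function.update ω k i)) / (k + 1) ∂urrtMeasure := by
  have e : G = fun ω => ∑ i : Fin (k + 1),
      (if ω k = i then (1 : ℝ) else 0) * G (Function.update ω k i) := by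
    ext ω
    simp
  have hdep : ∀ i : Fin (k + 1), DependsOn (fun ω : Attachments =>
      (if ω k = i then (1 : ℝ) else 0) * G (Function.update ω k i)) (Set.Iio (k + 1)) := by
    intro i ω ω' h
    have h1 := h k (Set.mem_Iio.2 (Nat.lt_succ_self k))
    have h2 := dependsOn_update hG i fun j hj => h j (lt_trans hj (Nat.lt_succ_self k))
    simp only [h1, h2]
  conv_lhs => rw [e]
  rw [integral_finsetSum _ fun i _ => (hdep i).integrable_attachments, integral_div,
    integral_finsetSum _ fun i _ => (dependsOn_update hG i).integrable_attachments,
    Finset.sum_div]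
  exact Finset.sum_congr rfl fun i _ => integral_indicator_coord_mul (dependsOn_update hG i) i

/-! ### Random vertex sets which are inherited by children -/

open Classical in
/-- The number of elements of `X` among the first `n` vertices. -/
noncomputable def countBelow (X : Set ℕ) (n : ℕ) : ℕ := Nat.count (· ∈ X) n

open Classical in
theorem countBelow_succ (X : Set ℕ) (n : ℕ) :
    countBelow X (n + 1) = countBelow X n + if n ∈ X then 1 else 0 :=
  Nat.count_succ _ _

open Classical in
theorem countBelow_mono (X : Set ℕ) : Monotone (countBelow X) := Nat.count_monotone _

theorem countBelow_congr {X Y : Set ℕ} {n : ℕ} (h : ∀ u < n, u ∈ X ↔ u ∈ Y) :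
    countBelow X n = countBelow Y n := by
  induction n with
  | zero => simp [countBelow]
  | succ n ih =>
    classical
    rw [countBelow_succ, countBelow_succ, ih fun u hu => h u (hu.trans n.lt_succ_self)]
    simp only [h n n.lt_succ_self]

theorem countBelow_add_countBelow_compl (X : Set ℕ) (n : ℕ) :
    countBelow X n + countBelow Xᶜ n = n := by
  induction n with
  | zero => simp [countBelow]
  | succ n ih =>
    classical
    rw [countBelow_succ, countBelow_succ]
    by_cases h : n ∈ X <;> simp [h] <;> omega

open Classical in
theorem sum_ite_mem_eq_countBelow (X : Set ℕ) (n : ℕ) :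
    ∑ i ∈ Finset.range n, (if i ∈ X then (1 : ℝ) else 0) = countBelow X n := by
  rw [countBelow, Nat.count_eq_card_filter_range]
  simp

/-- A random set `X` of vertices such that membership of a vertex is determined by the attachment
choices of this vertex and the earlier ones, and from vertex `m + 1` on,
a vertex belongs to `X` if and only if its parent does. -/
structure Inherited (m : ℕ) (X : Attachments → Set ℕ) : Prop where
  dependsOn : ∀ u, DependsOn (fun ω => u ∈ X ω) (Set.Iio u)
  succ_mem_iff : ∀ ω k, m ≤ k → (k + 1 ∈ X ω ↔ (ω k : ℕ) ∈ X ω)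

namespace Inherited

variable {m : ℕ} {X : Attachments → Set ℕ}

theorem compl (hX : Inherited m X) : Inherited m fun ω => (X ω)ᶜ where
  dependsOn u _ _ h := congrArg Not (hX.dependsOn u h)
  succ_mem_iff ω k hk := not_congr (hX.succ_mem_iff ω k hk)

theorem mono {m' : ℕ} (hX : Inherited m X) (h : m ≤ m') : Inherited m' X where
  dependsOn := hX.dependsOn
  succ_mem_iff ω k hk := hX.succ_mem_iff ω k (h.trans hk)

theorem dependsOn_countBelow (hX : Inherited m X) (k : ℕ) :
    DependsOn (fun ω => countBelow (X ω) (k + 1)) (Set.Iio k) := by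
  intro ω ω' h
  refine countBelow_congr fun u hu => ?_
  exact (hX.dependsOn u fun i hi => h i (lt_of_lt_of_le hi (Nat.lt_succ_iff.1 hu))).to_iff

open Classical in
theorem countBelow_update (hX : Inherited m X) {k : ℕ} (hk : m ≤ k) (ω : Attachments)
    (i : Fin (k + 1)) :
    countBelow (X (Function.update ω k i)) (k + 2)
      = countBelow (X ω) (k + 1) + if (i : ℕ) ∈ X ω then 1 else 0 := by
  have hagree : ∀ j < k, Function.update ω k i j = ω j := fun j hj =>
    Function.update_of_ne hj.ne _ _
  have h1 : ∀ u ≤ k, u ∈ X (Function.update ω k i) ↔ u ∈ X ω := fun u hu =>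
    (hX.dependsOn u fun j hj => hagree j (lt_of_lt_of_le hj hu)).to_iff
  have h0 : countBelow (X (Function.update ω k i)) (k + 1) = countBelow (X ω) (k + 1) :=
    hX.dependsOn_countBelow k fun j hj => hagree j hj
  rw [countBelow_succ, h0]
  have h2 : k + 1 ∈ X (Function.update ω k i) ↔ (i : ℕ) ∈ X ω := by
    rw [hX.succ_mem_iff _ _ hk, Function.update_self, h1 _ (Nat.lt_succ_iff.1 i.isLt)]
  simp only [h2]

end Inherited

open Classical in
/-- One step of the joint evolution of the sizes of two inherited sets. -/
theorem integral_growth_step {m k : ℕ} {X S : Attachments → Set ℕ} (hX : Inherited m X)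
    (hS : Inherited m S) (hk : m ≤ k) {W : Attachments → ℝ} (hW : DependsOn W (Set.Iio k))
    (ψ : ℕ → ℕ → ℝ) :
    ∫ ω, W ω * ψ (countBelow (X ω) (k + 2)) (countBelow (S ω) (k + 2)) ∂urrtMeasure
      = ∫ ω, W ω * ((∑ i ∈ Finset.range (k + 1),
          ψ (countBelow (X ω) (k + 1) + if i ∈ X ω then 1 else 0)
            (countBelow (S ω) (k + 1) + if i ∈ S ω then 1 else 0)) / (k + 1)) ∂urrtMeasure := by
  rw [integral_eq_integral_average (k := k)]
  · refine integral_congr_ae (ae_of_all _ fun ω => ?_)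
    have h1 : ∀ i : Fin (k + 1), W (Function.update ω k i) = W ω := fun i =>
      hW fun j hj => Function.update_of_ne (ne_of_lt hj) _ _
    simp only [h1, hX.countBelow_update hk, hS.countBelow_update hk, ← Finset.mul_sum]
    rw [mul_div_assoc, Finset.sum_range (n := k + 1)]
  · intro ω ω' h
    have h1 : W ω = W ω' := hW fun j hj => h j (lt_trans hj k.lt_succ_self)
    have h2 := hX.dependsOn_countBelow (k + 1) h
    have h3 := hS.dependsOn_countBelow (k + 1) h
    simp only at h2 h3
    simp only [h1, h2, h3]

open Classical in
-- A new vertex enlarges at most one of two disjoint sets, so the two increments decouple.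
theorem sum_growth_of_disjoint {X S : Set ℕ} (h : ∀ u, u ∈ S → u ∉ X) (n x s : ℕ)
    (ψ : ℕ → ℕ → ℝ) :
    ∑ i ∈ Finset.range n, ψ (x + if i ∈ X then 1 else 0) (s + if i ∈ S then 1 else 0)
      = n * ψ x s + countBelow X n * (ψ (x + 1) s - ψ x s)
        + countBelow S n * (ψ x (s + 1) - ψ x s) := by
  rw [← sum_ite_mem_eq_countBelow, ← sum_ite_mem_eq_countBelow, Finset.sum_mul, Finset.sum_mul]
  have : (n : ℝ) * ψ x s = ∑ i ∈ Finset.range n, ψ x s := by simp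
  rw [this, ← Finset.sum_add_distrib, ← Finset.sum_add_distrib]
  refine Finset.sum_congr rfl fun i _ => ?_
  by_cases h1 : i ∈ S
  · simp [h1, h i h1]
  · by_cases h2 : i ∈ X <;> simp [h1, h2]

open Classical in
-- Whenever the smaller set grows, so does the larger one; this is why the increment in `s` is taken
-- at `x + 1`.
theorem sum_growth_of_subset {X S : Set ℕ} (h : ∀ u, u ∈ S → u ∈ X) (n x s : ℕ)
    (ψ : ℕ → ℕ → ℝ) :
    ∑ i ∈ Finset.range n, ψ (x + if i ∈ X then 1 else 0) (s + if i ∈ S then 1 else 0)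
      = n * ψ x s + countBelow X n * (ψ (x + 1) s - ψ x s)
        + countBelow S n * (ψ (x + 1) (s + 1) - ψ (x + 1) s) := by
  rw [← sum_ite_mem_eq_countBelow, ← sum_ite_mem_eq_countBelow, Finset.sum_mul, Finset.sum_mul]
  have : (n : ℝ) * ψ x s = ∑ i ∈ Finset.range n, ψ x s := by simp
  rw [this, ← Finset.sum_add_distrib, ← Finset.sum_add_distrib]
  refine Finset.sum_congr rfl fun i _ => ?_
  by_cases h1 : i ∈ S
  · simp [h1, h i h1]
  · by_cases h2 : i ∈ X <;> simp [h1, h2]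

/-- One step of the evolution of the size of a single inherited set. -/
theorem integral_growth_step_single {m k : ℕ} {X : Attachments → Set ℕ} (hX : Inherited m X)
    (hk : m ≤ k) {W : Attachments → ℝ} (hW : DependsOn W (Set.Iio k)) (φ : ℕ → ℝ) :
    ∫ ω, W ω * φ (countBelow (X ω) (k + 2)) ∂urrtMeasure
      = ∫ ω, W ω * (φ (countBelow (X ω) (k + 1)) + countBelow (X ω) (k + 1) / (k + 1) *
          (φ (countBelow (X ω) (k + 1) + 1) - φ (countBelow (X ω) (k + 1)))) ∂urrtMeasure := by
  classical
  rw [integral_growth_step hX hX hk hW fun x _ => φ x]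
  refine integral_congr_ae (ae_of_all _ fun ω => ?_)
  simp only [sum_growth_of_subset (X := X ω) (S := X ω) (fun u hu => hu) (k + 1)
    _ (countBelow (X ω) (k + 1)) fun x _ => φ x]
  have : (k : ℝ) + 1 ≠ 0 := by positivity
  push_cast
  field_simp
  ring

/-! ### Descendants -/

/-- `Below ω v u` : the vertex `u` is a descendant of `v` (or `v` itself). -/
inductive Below (ω : Attachments) (v : ℕ) : ℕ → Prop
  | refl : Below ω v v
  | step (k : ℕ) : Below ω v (ω k) → Below ω v (k + 1)

/-- The descendants of `v`, including `v`. -/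
def descendants (v : ℕ) (ω : Attachments) : Set ℕ := {u | Below ω v u}

theorem Below.le {ω : Attachments} {v u : ℕ} (h : Below ω v u) : v ≤ u := by
  induction h with
  | refl => exact le_rfl
  | step k _ ih => exact ih.trans (ω k).isLt.le

theorem self_mem_descendants (v : ℕ) (ω : Attachments) : v ∈ descendants v ω := Below.refl

theorem succ_mem_descendants_iff {ω : Attachments} {v k : ℕ} :
    k + 1 ∈ descendants v ω ↔ k + 1 = v ∨ (ω k : ℕ) ∈ descendants v ω := by
  constructor
  · intro h
    have h : Below ω v (k + 1) := h
    cases h with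
    | refl => exact Or.inl rfl
    | step _ h => exact Or.inr h
  · rintro (rfl | h)
    · exact Below.refl
    · exact Below.step k h

theorem mem_descendants_congr (v u : ℕ) :
    DependsOn (fun ω => u ∈ descendants v ω) (Set.Iio u) := by
  induction u using Nat.strong_induction_on with
  | _ u ih =>
    intro ω ω' h
    rcases u with _ | k
    · refine propext ⟨fun hu => ?_, fun hu => ?_⟩
      · obtain rfl : v = 0 := Nat.le_zero.1 (Below.le hu)
        exact Below.refl
      · obtain rfl : v = 0 := Nat.le_zero.1 (Below.le hu)
        exact Below.refl
    · have hk : ω k = ω' k := h k (Set.mem_Iio.2 k.lt_succ_self)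
      refine propext ?_
      change k + 1 ∈ descendants v ω ↔ k + 1 ∈ descendants v ω'
      rw [succ_mem_descendants_iff, succ_mem_descendants_iff, ← hk]
      exact or_congr_right (ih _ (ω k).isLt fun j hj => h j (lt_trans hj (ω k).isLt)).to_iff

theorem inherited_descendants (v : ℕ) : Inherited v (descendants v) where
  dependsOn := mem_descendants_congr v
  succ_mem_iff ω k hk := by
    rw [succ_mem_descendants_iff]
    exact or_iff_right (by omega)

theorem countBelow_descendants_of_le {v n : ℕ} (h : n ≤ v) (ω : Attachments) :
    countBelow (descendants v ω) n = 0 := by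
  induction n with
  | zero => simp [countBelow]
  | succ n ih =>
    classical
    rw [countBelow_succ, ih (by omega), if_neg]
    intro hn
    have := Below.le hn
    omega

theorem countBelow_descendants_self (v : ℕ) (ω : Attachments) :
    countBelow (descendants v ω) (v + 1) = 1 := by
  classical
  rw [countBelow_succ, countBelow_descendants_of_le le_rfl, if_pos (self_mem_descendants v ω)]

theorem one_le_countBelow_descendants {v n : ℕ} (h : v < n) (ω : Attachments) :
    1 ≤ countBelow (descendants v ω) n :=
  (countBelow_descendants_self v ω).symm.le.trans (countBelow_mono _ h)

/-- From the birth of `v` on, an inherited set contains all of the descendants of `v` or none. -/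
theorem Inherited.mem_iff_of_mem_descendants {m v u : ℕ} {X : Attachments → Set ℕ}
    (hX : Inherited m X) (hm : m ≤ v) {ω : Attachments} (hu : u ∈ descendants v ω) :
    u ∈ X ω ↔ v ∈ X ω := by
  have hu : Below ω v u := hu
  induction hu with
  | refl => exact Iff.rfl
  | step k h ih =>
    rw [hX.succ_mem_iff ω k ?_]
    · exact ih h
    · have := Below.le h
      have := (ω k).isLt
      omega

/-! ### Laws of the sizes of inherited sets -/

/-- Summation by parts; it is what makes the urn carry the uniform law on `{1, …, N}` to the uniform
law on `{1, …, N + 1}`. -/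
theorem sum_Icc_mul_sub (φ : ℕ → ℝ) (N : ℕ) :
    ∑ a ∈ Finset.Icc 1 N, (a : ℝ) * (φ (a + 1) - φ a)
      = N * φ (N + 1) - ∑ a ∈ Finset.Icc 1 N, φ a := by
  induction N with
  | zero => simp
  | succ N ih =>
    rw [Finset.sum_Icc_succ_top (by omega), Finset.sum_Icc_succ_top (by omega), ih]
    push_cast
    ring

/-- If an inherited set contains exactly one of the first two vertices, then its size
among the first `k + 2` vertices is uniformly distributed on `{1, …, k + 1}`. -/
theorem Inherited.integral_comp_countBelow {X : Attachments → Set ℕ} (hX : Inherited 1 X)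
    (h2 : ∀ ω, countBelow (X ω) 2 = 1) (k : ℕ) (φ : ℕ → ℝ) :
    ∫ ω, φ (countBelow (X ω) (k + 2)) ∂urrtMeasure
      = (∑ a ∈ Finset.Icc 1 (k + 1), φ a) / (k + 1) := by
  induction k generalizing φ with
  | zero => simp [h2]
  | succ k ih =>
    have hW : DependsOn (fun _ : Attachments => (1 : ℝ)) (Set.Iio (k + 1)) := fun _ _ _ => rfl
    have := integral_growth_step_single hX (k := k + 1) (by omega) hW φ
    simp only [one_mul] at this
    rw [this, ih fun a => φ a + a / (((k + 1 : ℕ) : ℝ) + 1) * (φ (a + 1) - φ a)]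
    have e := sum_Icc_mul_sub φ (k + 1)
    have e2 : ∀ a : ℕ, (a : ℝ) / (((k + 1 : ℕ) : ℝ) + 1) * (φ (a + 1) - φ a)
        = (a * (φ (a + 1) - φ a)) / (((k + 1 : ℕ) : ℝ) + 1) := fun a => by ring
    simp only [e2]
    rw [Finset.sum_add_distrib, ← Finset.sum_div, e,
      Finset.sum_Icc_succ_top (a := 1) (b := k + 1) (by omega)]
    have h3 : (k : ℝ) + 1 ≠ 0 := by positivity
    have h4 : (k : ℝ) + 1 + 1 ≠ 0 := by positivity
    push_cast
    field_simp
    ring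

/-- A point `(a, b)` with `a + b = M + 1` is reached from `(a - 1, b)` with weight `a` and from `(a,
b - 1)` with weight `b`, in total `M + 1` for every point: the urn preserves uniformity on
antidiagonals. -/
theorem sum_antidiagonal_succ_mul (f : ℕ → ℕ → ℝ) (M : ℕ) :
    ∑ p ∈ Finset.HasAntidiagonal.antidiagonal M,
        (((p.1 : ℝ) + 1) * f (p.1 + 1) p.2 + (p.2 + 1) * f p.1 (p.2 + 1))
      = (M + 1) * ∑ p ∈ Finset.HasAntidiagonal.antidiagonal (M + 1), f p.1 p.2 := by
  have h1 := Finset.Nat.sum_antidiagonal_succ (n := M) (f := fun p : ℕ × ℕ => (p.1 : ℝ) * f p.1 p.2)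
  have h2 := Finset.Nat.sum_antidiagonal_succ' (n := M)
    (f := fun p : ℕ × ℕ => (p.2 : ℝ) * f p.1 p.2)
  simp only [Nat.cast_zero, zero_mul, zero_add, Nat.cast_add, Nat.cast_one] at h1 h2
  rw [Finset.sum_add_distrib, ← h1, add_comm, ← h2, Finset.mul_sum, ← Finset.sum_add_distrib]
  refine Finset.sum_congr rfl fun p hp => ?_
  have : p.1 + p.2 = M + 1 := Finset.HasAntidiagonal.mem_antidiagonal.1 hp
  have : (p.1 : ℝ) + p.2 = M + 1 := by exact_mod_cast this
  rw [← this]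
  ring

/-- Two disjoint inherited sets which consist of one vertex each at some time are exchangeable:
given their total size, all possible sizes are equally likely. -/
theorem integral_nonneg_of_sum_antidiagonal_nonneg {j : ℕ} (hj : 1 ≤ j)
    {X S : Attachments → Set ℕ} (hX : Inherited j X) (hS : Inherited j S)
    {W : Attachments → ℝ} (hW : DependsOn W (Set.Iio j)) (hW0 : ∀ ω, 0 ≤ W ω)
    (hX1 : ∀ ω, W ω ≠ 0 → countBelow (X ω) (j + 1) = 1)
    (hS1 : ∀ ω, W ω ≠ 0 → countBelow (S ω) (j + 1) = 1)
    (hdisj : ∀ ω, W ω ≠ 0 → ∀ u, u ∈ S ω → u ∉ X ω) {k : ℕ} (hk : j ≤ k) (φ : ℕ → ℕ → ℝ)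
    (hφ : ∀ M, M + 1 ≤ k → 0 ≤ ∑ p ∈ Finset.HasAntidiagonal.antidiagonal M, φ (p.1 + 1) (p.2 + 1)) :
    0 ≤ ∫ ω, W ω * φ (countBelow (X ω) (k + 1)) (countBelow (S ω) (k + 1)) ∂urrtMeasure := by
  induction k, hk using Nat.le_induction generalizing φ with
  | base =>
    refine integral_nonneg fun ω => ?_
    by_cases h : W ω = 0
    · simp [h]
    · simp only [Pi.zero_apply, hX1 ω h, hS1 ω h]
      have := hφ 0 (by omega)
      simp only [Finset.Nat.antidiagonal_zero, Finset.sum_singleton, zero_add] at this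
      exact mul_nonneg (hW0 ω) this
  | succ k hk ih =>
    have hk0 : (0 : ℝ) < k + 1 := by positivity
    rw [integral_growth_step hX hS hk (hW.mono (Set.Iio_subset_Iio hk))]
    have e : ∀ ω, W ω * ((∑ i ∈ Finset.range (k + 1),
          φ (countBelow (X ω) (k + 1) + open Classical in if i ∈ X ω then 1 else 0)
            (countBelow (S ω) (k + 1) + open Classical in if i ∈ S ω then 1 else 0)) / (k + 1))
        = W ω * (fun c s : ℕ => (((k : ℝ) + 1 - c - s) * φ c s
            + (c * φ (c + 1) s + s * φ c (s + 1))) / (k + 1))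
            (countBelow (X ω) (k + 1)) (countBelow (S ω) (k + 1)) := by
      intro ω
      by_cases h : W ω = 0
      · simp [h]
      · rw [sum_growth_of_disjoint (hdisj ω h)]
        push_cast
        ring
    simp only [e]
    -- The induction runs backwards in time: `φ` is replaced by its one-step conditional mean, whose
    -- antidiagonal sums are nonnegative combinations of those of `φ` at `M` (no growth) and `M +
    -- 1`. The bound `M + 1 ≤ k` keeps the no-growth weight nonnegative.
    refine ih (fun c s : ℕ => (((k : ℝ) + 1 - c - s) * φ c s
            + (c * φ (c + 1) s + s * φ c (s + 1))) / (k + 1)) fun M hM => ?_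
    rw [← Finset.sum_div, Finset.sum_add_distrib]
    refine div_nonneg (add_nonneg ?_ ?_) hk0.le
    · have : ∀ p ∈ Finset.HasAntidiagonal.antidiagonal M,
          ((k : ℝ) + 1 - (p.1 + 1 : ℕ) - (p.2 + 1 : ℕ)) * φ (p.1 + 1) (p.2 + 1)
            = ((k : ℝ) - 1 - M) * φ (p.1 + 1) (p.2 + 1) := by
        intro p hp
        have : p.1 + p.2 = M := Finset.HasAntidiagonal.mem_antidiagonal.1 hp
        rw [← this]
        push_cast
        ring
      rw [Finset.sum_congr rfl this, ← Finset.mul_sum]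
      refine mul_nonneg ?_ (hφ M (by omega))
      have : (M : ℝ) + 1 ≤ k := by exact_mod_cast hM
      linarith
    · have := sum_antidiagonal_succ_mul (fun a b => φ (a + 1) (b + 1)) M
      push_cast
      rw [this]
      exact mul_nonneg (by positivity) (hφ (M + 1) (by omega))

/-- The proportion of vertices in `S` is a martingale, equal to `1 / (j + 1)` at time `j`; `W` is a
weight known at that time. -/
theorem integral_mul_countBelow {j : ℕ} {S : Attachments → Set ℕ} (hS : Inherited j S)
    {W : Attachments → ℝ} (hW : DependsOn W (Set.Iio j))
    (hS1 : ∀ ω, countBelow (S ω) (j + 1) = 1) {k : ℕ} (hk : j ≤ k) :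
    ∫ ω, W ω * (countBelow (S ω) (k + 1) : ℝ) ∂urrtMeasure
      = (k + 1) / (j + 1) * ∫ ω, W ω ∂urrtMeasure := by
  induction k, hk using Nat.le_induction with
  | base =>
    have : (j : ℝ) + 1 ≠ 0 := by positivity
    simp [hS1, this]
  | succ k hk ih =>
    have h1 : (j : ℝ) + 1 ≠ 0 := by positivity
    have h2 : (k : ℝ) + 1 ≠ 0 := by positivity
    rw [integral_growth_step_single hS hk (hW.mono (Set.Iio_subset_Iio hk)) fun s => (s : ℝ)]
    have e : ∀ ω, W ω * ((countBelow (S ω) (k + 1) : ℝ) + countBelow (S ω) (k + 1) / (k + 1) *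
          (((countBelow (S ω) (k + 1) + 1 : ℕ) : ℝ) - countBelow (S ω) (k + 1)))
        = (W ω * (countBelow (S ω) (k + 1) : ℝ)) * ((k + 2) / (k + 1)) := by
      intro ω
      push_cast
      field_simp
      ring
    simp only [e]
    rw [integral_mul_const, ih]
    push_cast
    field_simp
    ring

/-! ### Inverse moments -/

/-- The function `1 / ((x - 1) (x - 2))`. -/
noncomputable def invSq (x : ℕ) : ℝ := 1 / (((x : ℝ) - 1) * (x - 2))

theorem invSq_nonneg {x : ℕ} (hx : 3 ≤ x) : 0 ≤ invSq x := by
  have : (3 : ℝ) ≤ x := by exact_mod_cast hx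
  exact div_nonneg zero_le_one (mul_nonneg (by linarith) (by linarith))

/-- This identity makes `invSq` an eigenfunction of the urn step: averaging over the attachment to
`k + 1` vertices multiplies it by `(k - 1) / (k + 1)`. It needs `3 ≤ x`, away from the poles. -/
theorem mul_invSq_succ_sub {x : ℕ} (hx : 3 ≤ x) :
    (x : ℝ) * (invSq (x + 1) - invSq x) = -2 * invSq x := by
  have : (3 : ℝ) ≤ x := by exact_mod_cast hx
  have h1 : (x : ℝ) - 1 ≠ 0 := by linarith
  have h2 : (x : ℝ) - 2 ≠ 0 := by linarith
  have h3 : (x : ℝ) ≠ 0 := by linarith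
  have h4 : (x : ℝ) + 1 - 1 ≠ 0 := by linarith
  have h5 : (x : ℝ) + 1 - 2 ≠ 0 := by linarith
  unfold invSq
  push_cast
  field_simp
  ring

theorem invSq_succ_le {x : ℕ} (hx : 3 ≤ x) : invSq (x + 1) ≤ invSq x := by
  have h1 := mul_invSq_succ_sub hx
  have h2 := invSq_nonneg hx
  have h3 : (0 : ℝ) < x := by exact_mod_cast (by omega : 0 < x)
  by_contra h
  have := mul_pos h3 (sub_pos.2 (not_le.1 h))
  linarith

theorem sum_invSq_le (q : ℕ) (hq : 2 ≤ q) :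
    ∑ a ∈ Finset.Icc 1 q, (if 3 ≤ a then (1 : ℝ) else 0) * invSq a ≤ 1 - 1 / (q - 1) := by
  induction q, hq using Nat.le_induction with
  | base => rw [Finset.sum_eq_zero]; norm_num; intro a ha; simp at ha; simp; omega
  | succ q hq ih =>
    rw [Finset.sum_Icc_succ_top (by omega), if_pos (by omega)]
    have : (2 : ℝ) ≤ q := by exact_mod_cast hq
    have h1 : (q : ℝ) - 1 ≠ 0 := by linarith
    have h2 : (q : ℝ) ≠ 0 := by linarith
    have : 1 * invSq (q + 1) = 1 / ((q : ℝ) - 1) - 1 / ((q + 1 : ℕ) - 1) := by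
      unfold invSq
      push_cast
      rw [show (q : ℝ) + 1 - 1 = q by ring, show (q : ℝ) + 1 - 2 = q - 1 by ring]
      field_simp
      ring
    rw [this]
    linarith

/-- At time `q` the size is uniform and the sum of `invSq` telescopes, giving at most `1 / q`.
Afterwards the factors `(k - 1) / (k + 1)` telescope to `q(q - 1) / (k(k - 1))`. The indicator keeps
the size at least three, hence away from the poles of `invSq`. -/
theorem Inherited.integral_invSq_le {X : Attachments → Set ℕ} (hX : Inherited 1 X)
    (h2 : ∀ ω, countBelow (X ω) 2 = 1) {q : ℕ} (hq : 2 ≤ q) {k : ℕ} (hk : q ≤ k) :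
    ∫ ω, (if 3 ≤ countBelow (X ω) (q + 1) then (1 : ℝ) else 0)
        * invSq (countBelow (X ω) (k + 1)) ∂urrtMeasure
      ≤ ((q : ℝ) - 1) / (k * (k - 1)) := by
  induction k, hk using Nat.le_induction with
  | base =>
    obtain ⟨r, rfl⟩ : ∃ r, q = r + 1 := ⟨q - 1, by omega⟩
    rw [hX.integral_comp_countBelow h2 r fun a => (if 3 ≤ a then (1 : ℝ) else 0) * invSq a]
    have h1 := sum_invSq_le (r + 1) hq
    have hr : (1 : ℝ) ≤ r := by exact_mod_cast (by omega : 1 ≤ r)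
    have hr' : (r : ℝ) ≠ 0 := by linarith
    push_cast at h1 ⊢
    rw [show (r : ℝ) + 1 - 1 = r by ring] at *
    have h3 : 0 ≤ 1 / (r : ℝ) := by positivity
    rw [div_le_div_iff₀ (by linarith) (by positivity)]
    calc _ ≤ 1 * ((r + 1 : ℝ) * r) := by gcongr; linarith
      _ = _ := by ring
  | succ k hk ih =>
    have hW : DependsOn (fun ω => if 3 ≤ countBelow (X ω) (q + 1) then (1 : ℝ) else 0)
        (Set.Iio k) := by
      intro ω ω' h
      have : countBelow (X ω) (q + 1) = countBelow (X ω') (q + 1) :=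
        (hX.dependsOn_countBelow q).mono (Set.Iio_subset_Iio hk) h
      simp only [this]
    rw [integral_growth_step_single hX (by omega) hW invSq]
    have hk2 : (2 : ℝ) ≤ k := by exact_mod_cast hq.trans hk
    have h3 : (k : ℝ) + 1 ≠ 0 := by positivity
    have h4 : (k : ℝ) - 1 ≠ 0 := by linarith
    have h5 : (k : ℝ) ≠ 0 := by linarith
    have e : ∀ ω, (if 3 ≤ countBelow (X ω) (q + 1) then (1 : ℝ) else 0)
        * (invSq (countBelow (X ω) (k + 1)) + countBelow (X ω) (k + 1) / (k + 1) *
          (invSq (countBelow (X ω) (k + 1) + 1) - invSq (countBelow (X ω) (k + 1))))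
        = ((if 3 ≤ countBelow (X ω) (q + 1) then (1 : ℝ) else 0)
          * invSq (countBelow (X ω) (k + 1))) * ((k - 1) / (k + 1)) := by
      intro ω
      split_ifs with h
      · have h6 := mul_invSq_succ_sub (h.trans (countBelow_mono (X ω) (by omega : q + 1 ≤ k + 1)))
        rw [div_mul_eq_mul_div, h6]
        field_simp
        ring
      · simp
    simp only [e]
    rw [integral_mul_const]
    refine (mul_le_mul_of_nonneg_right ih (div_nonneg (by linarith) (by linarith))).trans ?_
    push_cast
    rw [show (k : ℝ) + 1 - 1 = k by ring]
    apply le_of_eq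
    field_simp

/-- The expected ratio of squared sizes of the progeny of `j` and of an inherited set. -/
theorem Inherited.integral_descendants_mul_invSq_le {X : Attachments → Set ℕ} (hX : Inherited 1 X)
    (h2 : ∀ ω, countBelow (X ω) 2 = 1) {q : ℕ} (hq : 2 ≤ q) {j : ℕ} (hj : q ≤ j)
    {k : ℕ} (hk : j ≤ k) :
    ∫ ω, (if 3 ≤ countBelow (X ω) (q + 1) then (1 : ℝ) else 0)
        * (((countBelow (descendants j ω) (k + 1) : ℝ) * (countBelow (descendants j ω) (k + 1) + 1))
          * invSq (countBelow (X ω) (k + 1))) ∂urrtMeasure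
      ≤ 2 * (((q : ℝ) - 1) / (j * (j - 1))) := by
  induction k, hk using Nat.le_induction with
  | base =>
    simp only [countBelow_descendants_self]
    refine le_trans (le_of_eq ?_)
      (mul_le_mul_of_nonneg_left (hX.integral_invSq_le h2 hq hj) zero_le_two)
    rw [← integral_const_mul]
    refine integral_congr_ae (ae_of_all _ fun ω => ?_)
    simp only [Nat.cast_one]
    ring
  | succ k hk ih =>
    have hW : DependsOn (fun ω => if 3 ≤ countBelow (X ω) (q + 1) then (1 : ℝ) else 0)
        (Set.Iio k) := by
      intro ω ω' h
      have : countBelow (X ω) (q + 1) = countBelow (X ω') (q + 1) :=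
        (hX.dependsOn_countBelow q).mono (Set.Iio_subset_Iio (hj.trans hk)) h
      simp only [this]
    have hXj := hX.mono (show 1 ≤ j by omega)
    have hS := inherited_descendants j
    refine le_trans ?_ ih
    rw [integral_growth_step hXj hS hk hW
      fun x s => ((s : ℝ) * (s + 1)) * invSq x]
    have hdX := hX.dependsOn_countBelow k
    have hdS := hS.dependsOn_countBelow k
    have hk0 : (0 : ℝ) < k + 1 := by positivity
    have hmem : ∀ u ≤ k, DependsOn (fun ω => u ∈ X ω) (Set.Iio k) := fun u hu =>
      (hX.dependsOn u).mono (Set.Iio_subset_Iio hu)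
    have hmem' : ∀ u ≤ k, DependsOn (fun ω => u ∈ descendants j ω) (Set.Iio k) := fun u hu =>
      (hS.dependsOn u).mono (Set.Iio_subset_Iio hu)
    refine integral_mono (DependsOn.integrable_attachments (k := k) ?_)
      (DependsOn.integrable_attachments (k := k) ?_) ?_
    · intro ω ω' h
      have e1 := hW h
      have e2 : countBelow (X ω) (k + 1) = _ := hdX h
      have e3 : countBelow (descendants j ω) (k + 1) = _ := hdS h
      beta_reduce at e1 e2 e3
      simp only [e1, e2, e3]
      congr 2
      refine Finset.sum_congr rfl fun i hi => ?_
      have hi : i ≤ k := Nat.lt_succ_iff.1 (Finset.mem_range.1 hi)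
      have e4 : i ∈ X ω ↔ i ∈ X ω' := (hmem i hi h).to_iff
      have e5 : i ∈ descendants j ω ↔ i ∈ descendants j ω' := (hmem' i hi h).to_iff
      classical
      simp only [e4, e5]
    · intro ω ω' h
      have e1 := hW h
      have e2 : countBelow (X ω) (k + 1) = _ := hdX h
      have e3 : countBelow (descendants j ω) (k + 1) = _ := hdS h
      beta_reduce at e1 e2 e3
      simp only [e1, e2, e3]
    · intro ω
      beta_reduce
      split_ifs with h
      · have hx := h.trans (countBelow_mono (X ω) (by omega : q + 1 ≤ k + 1))
        have h6 := mul_invSq_succ_sub hx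
        have h7 := invSq_succ_le hx
        rw [one_mul, one_mul, div_le_iff₀ hk0]
        set s := countBelow (descendants j ω) (k + 1) with hs
        set x := countBelow (X ω) (k + 1) with hx'
        have h8 : (0 : ℝ) ≤ s * (s + 1) := by positivity
        -- In the mean, growth of `s` raises `s(s + 1)` by the relative amount `2 / (k + 1)`, and
        -- growth of `x` lowers `invSq x` by the same. In the disjoint case these cancel exactly; if
        -- the progeny lies in `X`, the two grow together, and monotonicity of `invSq` gives an
        -- inequality.
        by_cases hjX : j ∈ X ω
        · rw [sum_growth_of_subset (X := X ω) (S := descendants j ω) (fun u hu =>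
            (hXj.mem_iff_of_mem_descendants le_rfl hu).2 hjX) _ _ _
            fun x s : ℕ => ((s : ℝ) * (s + 1)) * invSq x]
          rw [← hs, ← hx']
          push_cast
          have := mul_le_mul_of_nonneg_left h7 h8
          linear_combination 2 * this + (s * (s + 1) : ℝ) * h6
        · rw [sum_growth_of_disjoint (X := X ω) (S := descendants j ω) (fun u hu =>
            mt (hXj.mem_iff_of_mem_descendants le_rfl hu).1 hjX) _ _ _
            fun x s : ℕ => ((s : ℝ) * (s + 1)) * invSq x]
          rw [← hs, ← hx']
          push_cast
          apply le_of_eq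
          linear_combination (s * (s + 1) : ℝ) * h6
      · simp

/-! ### Bounds for the betweenness centrality -/

/-- Paths in a tree are unique, so no pair from `X × X` is counted for `v`, while all counted pairs
and all of `X × X` lie in the square of the complement of `v`. -/
theorem betweenness_add_sq_le {V : Type*} [Finite V] {T : SimpleGraph V} (hT : T.IsTree) {v : V}
    {X : Set V} (hv : v ∉ X) (h : ∀ p ∈ X, ∀ q ∈ X, ∃ w : T.Walk p q, v ∉ w.support) :
    betweenness T v + X.ncard ^ 2 ≤ (Nat.card V - 1) ^ 2 := by
  classical
  have hsub : {p : V × V | p.1 ≠ v ∧ p.2 ≠ v ∧ ∃ w : T.Walk p.1 p.2, w.IsPath ∧ v ∈ w.support}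
      ∪ X ×ˢ X ⊆ ({v}ᶜ : Set V) ×ˢ ({v}ᶜ : Set V) := by
    rintro ⟨a, b⟩ (⟨ha, hb, -⟩ | ⟨ha, hb⟩)
    · exact ⟨ha, hb⟩
    · exact ⟨fun e => hv (e ▸ ha), fun e => hv (e ▸ hb)⟩
  have hdisj : Disjoint
      {p : V × V | p.1 ≠ v ∧ p.2 ≠ v ∧ ∃ w : T.Walk p.1 p.2, w.IsPath ∧ v ∈ w.support}
      (X ×ˢ X) := by
    rw [Set.disjoint_left]
    rintro ⟨a, b⟩ ⟨-, -, w, hw, hvw⟩ ⟨ha, hb⟩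
    obtain ⟨w', hw'⟩ := h a ha b hb
    have e := (hT.existsUnique_path a b).unique hw w'.bypass_isPath
    exact hw' (w'.support_bypass_subset_support (e ▸ hvw))
  have h1 := Set.ncard_le_ncard hsub (Set.toFinite _)
  rw [Set.ncard_union_eq hdisj (Set.toFinite _) (Set.toFinite _), Set.ncard_prod, Set.ncard_prod,
    Set.ncard_compl, Set.ncard_singleton] at h1
  rw [sq, sq]
  exact h1

theorem two_mul_le_betweenness {V : Type*} [Finite V] {T : SimpleGraph V} (hT : T.Connected) {v : V}
    {X Y : Set V} (hX : v ∉ X) (hY : v ∉ Y) (hXY : Disjoint X Y)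
    (h : ∀ p ∈ X, ∀ q ∈ Y, ∀ w : T.Walk p q, v ∈ w.support) :
    2 * (X.ncard * Y.ncard) ≤ betweenness T v := by
  classical
  have hdisj : Disjoint (X ×ˢ Y) (Y ×ˢ X) := by
    rw [Set.disjoint_left]
    rintro ⟨a, b⟩ ⟨ha, -⟩ ⟨ha', -⟩
    exact Set.disjoint_left.1 hXY ha ha'
  have hsub : X ×ˢ Y ∪ Y ×ˢ X ⊆
      {p : V × V | p.1 ≠ v ∧ p.2 ≠ v ∧ ∃ w : T.Walk p.1 p.2, w.IsPath ∧ v ∈ w.support} := by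
    rintro ⟨a, b⟩ (⟨ha, hb⟩ | ⟨ha, hb⟩)
    · obtain ⟨w, hw⟩ := hT.exists_isPath a b
      exact ⟨fun e => hX (e ▸ ha), fun e => hY (e ▸ hb), w, hw, h a ha b hb w⟩
    · obtain ⟨w, hw⟩ := hT.exists_isPath a b
      refine ⟨fun e => hY (e ▸ ha), fun e => hX (e ▸ hb), w, hw, ?_⟩
      have := h b hb a ha w.reverse
      simpa using this
  have h1 := Set.ncard_le_ncard hsub (Set.toFinite _)
  rw [Set.ncard_union_eq hdisj (Set.toFinite _) (Set.toFinite _), Set.ncard_prod,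
    Set.ncard_prod] at h1
  unfold betweenness
  linarith [mul_comm X.ncard Y.ncard]

theorem ncard_fin_eq_countBelow (X : Set ℕ) (n : ℕ) :
    {u : Fin n | (u : ℕ) ∈ X}.ncard = countBelow X n := by
  classical
  have : {u : Fin n | (u : ℕ) ∈ X}.ncard
      = ((fun u : Fin n => (u : ℕ)) '' {u : Fin n | (u : ℕ) ∈ X}).ncard :=
    (Set.ncard_image_of_injective _ Fin.val_injective).symm
  rw [this, countBelow, Nat.count_eq_card_filter_range, ← Set.ncard_coe_finset]
  congr 1
  ext u
  simp only [Set.mem_image, Set.mem_ofPred_eq, Finset.coe_filter, Finset.mem_range]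
  constructor
  · rintro ⟨x, hx, rfl⟩
    exact ⟨x.isLt, hx⟩
  · rintro ⟨hu, hx⟩
    exact ⟨⟨u, hu⟩, hx, rfl⟩

/-- The only edge leaving the progeny of `v` joins `v` to its parent. -/
theorem urrt_adj_boundary {ω : Attachments} {n v : ℕ} {a b : Fin n} (hab : (urrt ω n).Adj a b)
    (ha : (a : ℕ) ∈ descendants v ω) (hb : (b : ℕ) ∉ descendants v ω) :
    (a : ℕ) = v ∧ ∃ k : ℕ, v = k + 1 ∧ (b : ℕ) = ω k := by
  rcases ((SimpleGraph.fromRel_adj _ _ _).1 hab).2 with ⟨k, h1, h2⟩ | ⟨k, h1, h2⟩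
  · rw [h1, succ_mem_descendants_iff, ← h2] at hb
    exact absurd (Or.inr ha) hb
  · rw [h1, succ_mem_descendants_iff, ← h2] at ha
    have := ha.resolve_right hb
    exact ⟨h1.trans this, k, this.symm, h2⟩

theorem exists_walk_in_descendants {ω : Attachments} {n v : ℕ} (hv : v < n) {u : ℕ}
    (hu : Below ω v u) (hun : u < n) :
    ∃ w : (urrt ω n).Walk ⟨v, hv⟩ ⟨u, hun⟩, ∀ x ∈ w.support, (x : ℕ) ∈ descendants v ω := by
  induction hu with
  | refl => exact ⟨.nil, by simp [self_mem_descendants]⟩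
  | step k h ih =>
    obtain ⟨w, hw⟩ := ih (lt_trans (ω k).isLt hun)
    refine ⟨w.concat (urrt_adj_attachment ω n k hun), fun x hx => ?_⟩
    rw [SimpleGraph.Walk.support_concat, List.mem_append] at hx
    rcases hx with hx | hx
    · exact hw x hx
    · rw [List.mem_singleton.1 hx]
      exact Below.step k h

theorem exists_walk_avoiding_descendants {ω : Attachments} {n v : ℕ} (hn : 0 < n) (u : ℕ)
    (hu : u ∉ descendants v ω) (hun : u < n) :
    ∃ w : (urrt ω n).Walk ⟨0, hn⟩ ⟨u, hun⟩, ∀ x ∈ w.support, (x : ℕ) ∉ descendants v ω := by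
  induction u using Nat.strong_induction_on with
  | _ u ih =>
    rcases u with _ | k
    · refine ⟨.nil, fun x hx => ?_⟩
      rw [SimpleGraph.Walk.support_nil, List.mem_singleton] at hx
      rwa [hx]
    · have hk := hu
      rw [succ_mem_descendants_iff, not_or] at hk
      obtain ⟨w, hw⟩ := ih _ (ω k).isLt hk.2 (lt_trans (ω k).isLt hun)
      refine ⟨w.concat (urrt_adj_attachment ω n k hun), fun x hx => ?_⟩
      rw [SimpleGraph.Walk.support_concat, List.mem_append] at hx
      rcases hx with hx | hx
      · exact hw x hx
      · rwa [List.mem_singleton.1 hx]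

/-- The non-descendants of `v` are connected to each other through the root without meeting `v`. For
the root itself there are none, and the bound is trivial. -/
theorem betweenness_le_of_ne_root (ω : Attachments) {n : ℕ} (v : Fin n) :
    betweenness (urrt ω n) v + countBelow (descendants v ω)ᶜ n ^ 2 ≤ (n - 1) ^ 2 := by
  have hn : 0 < n := v.pos
  have h := betweenness_add_sq_le (urrt_isTree ω n hn) (v := v)
    (X := {u : Fin n | (u : ℕ) ∈ (descendants v ω)ᶜ})
    (fun h => h (self_mem_descendants _ _)) fun p hp q hq => by
      obtain ⟨w, hw⟩ := exists_walk_avoiding_descendants hn p hp p.isLt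
      obtain ⟨w', hw'⟩ := exists_walk_avoiding_descendants hn q hq q.isLt
      refine ⟨w.reverse.append w', fun hv => ?_⟩
      rw [SimpleGraph.Walk.mem_support_append_iff, SimpleGraph.Walk.support_reverse,
        List.mem_reverse] at hv
      exact hv.elim (fun h => hw v h (self_mem_descendants _ _))
        fun h => hw' v h (self_mem_descendants _ _)
  rwa [ncard_fin_eq_countBelow, Nat.card_eq_fintype_card, Fintype.card_fin] at h

theorem zero_notMem_descendants {v : ℕ} (hv : 0 < v) (ω : Attachments) :
    0 ∉ descendants v ω := fun h => by
  have := Below.le h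
  omega

theorem betweenness_root_le (ω : Attachments) {n v : ℕ} (hv : 0 < v) (hvn : v < n) :
    betweenness (urrt ω n) ⟨0, hv.trans hvn⟩ + countBelow (descendants v ω) n ^ 2
      ≤ (n - 1) ^ 2 := by
  have h0 := zero_notMem_descendants hv ω
  have h := betweenness_add_sq_le (urrt_isTree ω n (hv.trans hvn)) (v := ⟨0, hv.trans hvn⟩)
    (X := {u : Fin n | (u : ℕ) ∈ descendants v ω}) h0 fun p hp q hq => by
      obtain ⟨w, hw⟩ := exists_walk_in_descendants hvn hp p.isLt
      obtain ⟨w', hw'⟩ := exists_walk_in_descendants hvn hq q.isLt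
      refine ⟨w.reverse.append w', fun hv => ?_⟩
      rw [SimpleGraph.Walk.mem_support_append_iff, SimpleGraph.Walk.support_reverse,
        List.mem_reverse] at hv
      exact hv.elim (fun h => h0 (hw _ h)) fun h => h0 (hw' _ h)
  rwa [ncard_fin_eq_countBelow, Nat.card_eq_fintype_card, Fintype.card_fin] at h

theorem le_betweenness (ω : Attachments) {n : ℕ} (v : Fin n) :
    2 * ((countBelow (descendants v ω) n - 1) * countBelow (descendants v ω)ᶜ n)
      ≤ betweenness (urrt ω n) v := by
  have h := two_mul_le_betweenness (urrt_isTree ω n v.pos).connected (v := v)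
    (X := {u : Fin n | (u : ℕ) ∈ descendants v ω} \ {v})
    (Y := {u : Fin n | (u : ℕ) ∈ (descendants v ω)ᶜ})
    (fun h => h.2 rfl) (fun h => h (self_mem_descendants _ _))
    (Set.disjoint_left.2 fun u hu hu' => hu' hu.1) fun p hp q hq w => by
      obtain ⟨d, hd, h1, h2⟩ := w.exists_boundary_dart
        {u : Fin n | (u : ℕ) ∈ descendants v ω} hp.1 hq
      have := (urrt_adj_boundary d.adj h1 h2).1
      rw [← Fin.ext this]
      exact w.dart_fst_mem_support_of_mem_darts hd
  rwa [Set.ncard_sdiff_singleton_of_mem (a := v) (s := {u : Fin n | (u : ℕ) ∈ descendants v ω})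
    (self_mem_descendants _ _), ncard_fin_eq_countBelow,
    ncard_fin_eq_countBelow] at h

/-- Since the parent of `1` is the root, the root separates the progeny of `1` from all other
non-root vertices. -/
theorem le_betweenness_root (ω : Attachments) {n : ℕ} (hn : 0 < n) :
    2 * (countBelow (descendants 1 ω) n * (countBelow (descendants 1 ω)ᶜ n - 1))
      ≤ betweenness (urrt ω n) ⟨0, hn⟩ := by
  have h0 := zero_notMem_descendants one_pos ω
  have h := two_mul_le_betweenness (urrt_isTree ω n hn).connected (v := ⟨0, hn⟩)
    (X := {u : Fin n | (u : ℕ) ∈ descendants 1 ω})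
    (Y := {u : Fin n | (u : ℕ) ∈ (descendants 1 ω)ᶜ} \ {⟨0, hn⟩})
    h0 (fun h => h.2 rfl)
    (Set.disjoint_left.2 fun u hu hu' => hu'.1 hu) fun p hp q hq w => by
      obtain ⟨d, hd, h1, h2⟩ := w.exists_boundary_dart
        {u : Fin n | (u : ℕ) ∈ descendants 1 ω} hp hq.1
      obtain ⟨-, k, hk, hb⟩ := urrt_adj_boundary d.adj h1 h2
      obtain rfl : k = 0 := by omega
      have h00 := (ω 0).isLt
      have : (⟨0, hn⟩ : Fin n) = d.snd := Fin.ext (hb.trans (by omega : (ω 0 : ℕ) = 0)).symm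
      rw [this]
      exact w.dart_snd_mem_support_of_mem_darts hd
  rwa [Set.ncard_sdiff_singleton_of_mem h0, ncard_fin_eq_countBelow,
    ncard_fin_eq_countBelow] at h

/-! ### The rank of the root -/

/-- In `T_n` the vertex `j` is ranked before the root. -/
def BeatsRoot (n : ℕ) (ω : Attachments) (j : ℕ) : Prop :=
  ∃ hj : j < n, 0 < j ∧
    betweenness (urrt ω n) ⟨0, Nat.zero_lt_of_lt hj⟩ ≤ betweenness (urrt ω n) ⟨j, hj⟩

/-- The root has the smallest label and loses every tie, so a weak inequality of betweenness
suffices. -/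
theorem rankedBefore_root_iff {n : ℕ} (hn : 0 < n) (ω : Attachments) (v : Fin n) :
    RankedBefore (betweenness (urrt ω n)) v ⟨0, hn⟩ ↔ BeatsRoot n ω v := by
  constructor
  · rintro (h | ⟨h, h0⟩)
    · refine ⟨v.isLt, Nat.pos_of_ne_zero fun h0 => ?_, h.le⟩
      have : v = ⟨0, hn⟩ := Fin.ext h0
      rw [this] at h
      exact lt_irrefl _ h
    · exact ⟨v.isLt, h0, h.ge⟩
  · rintro ⟨h1, h2, h3⟩
    rcases h3.lt_or_eq with h | h
    · exact Or.inl h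
    · exact Or.inr ⟨h.symm, h2⟩

open Classical in
theorem rootRank_eq {n : ℕ} (hn : 0 < n) (ω : Attachments) :
    rootRank n ω = 1 + ((Finset.range n).filter (BeatsRoot n ω)).card := by
  rw [rootRank, dif_pos hn, betweennessRank, centralityRank]
  have : {v : Fin n | RankedBefore (betweenness (urrt ω n)) v ⟨0, hn⟩}
      = {v : Fin n | (v : ℕ) ∈ {j | BeatsRoot n ω j}} :=
    Set.ext fun v => rankedBefore_root_iff hn ω v
  rw [this, ncard_fin_eq_countBelow, countBelow, Nat.count_eq_card_filter_range]
  rfl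

theorem rootRank_le (n : ℕ) (ω : Attachments) : rootRank n ω ≤ n := by
  classical
  rcases n.eq_zero_or_pos with rfl | hn
  · simp [rootRank]
  · rw [rootRank_eq hn]
    have h : (Finset.range n).filter (BeatsRoot n ω) ⊆ (Finset.range n).erase 0 := by
      intro j hj
      rw [Finset.mem_filter] at hj
      obtain ⟨-, h, -⟩ := hj.2
      exact Finset.mem_erase.2 ⟨h.ne', hj.1⟩
    have h2 := Finset.card_le_card h
    rw [Finset.card_erase_of_mem (Finset.mem_range.2 hn), Finset.card_range] at h2
    omega

theorem urrt_dependsOn (n : ℕ) : DependsOn (fun ω => urrt ω n) (Set.Iio (n - 1)) := by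
  intro ω ω' h
  have key : ∀ ω ω' : Attachments, (∀ i ∈ Set.Iio (n - 1), ω i = ω' i) → ∀ a b : Fin n,
      (∃ k : ℕ, (b : ℕ) = k + 1 ∧ (a : ℕ) = ω k) → ∃ k : ℕ, (b : ℕ) = k + 1 ∧ (a : ℕ) = ω' k := by
    rintro ω ω' h a b ⟨k, hb, ha⟩
    have : k < n - 1 := by
      have := b.isLt
      omega
    exact ⟨k, hb, by rw [← h k this, ha]⟩
  have h' : ∀ i ∈ Set.Iio (n - 1), ω' i = ω i := fun i hi => (h i hi).symm
  change SimpleGraph.fromRel _ = SimpleGraph.fromRel _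
  congr 1
  ext a b
  exact ⟨key ω ω' h a b, key ω' ω h' a b⟩

theorem rootRank_dependsOn (n : ℕ) : DependsOn (rootRank n) (Set.Iio (n - 1)) := by
  intro ω ω' h
  have e : urrt ω n = urrt ω' n := urrt_dependsOn n h
  unfold rootRank betweennessRank
  rw [e]

theorem integrable_rootRank (n : ℕ) :
    Integrable (fun ω => (rootRank n ω : ℝ)) urrtMeasure :=
  DependsOn.integrable_attachments (k := n - 1) fun ω ω' h => by
    simp only [rootRank_dependsOn n h]

theorem measurableSet_rootRank (n : ℕ) (P : ℕ → Prop) :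
    MeasurableSet {ω | P (rootRank n ω)} :=
  DependsOn.measurableSet_attachments (k := n - 1) fun ω ω' h => by
    simp only [rootRank_dependsOn n h]

theorem measureReal_eq_integral_ite {P : Attachments → Prop} [DecidablePred P]
    (hP : MeasurableSet {ω | P ω}) :
    urrtMeasure.real {ω | P ω} = ∫ ω, (if P ω then (1 : ℝ) else 0) ∂urrtMeasure := by
  have := integral_indicator_one (μ := urrtMeasure) hP
  rw [← this]
  refine integral_congr_ae (ae_of_all _ fun ω => ?_)
  by_cases h : P ω <;> simp [h]

/-! ### The root as a leaf -/

theorem countBelow_compl_descendants_one_two (ω : Attachments) :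
    countBelow (descendants 1 ω)ᶜ 2 = 1 := by
  have h1 : countBelow (descendants 1 ω) 2 = 1 := countBelow_descendants_self 1 ω
  have h2 := countBelow_add_countBelow_compl (descendants 1 ω) 2
  rw [h1] at h2
  exact Nat.add_left_cancel (h2.trans (one_add_one_eq_two).symm)

/-- Vertex `1` is always adjacent to the root; it is the only neighbour exactly when every non-root
vertex descends from it. -/
theorem rootIsLeaf_iff {n : ℕ} (hn : 2 ≤ n) (ω : Attachments) :
    RootIsLeaf n ω ↔ countBelow (descendants 1 ω)ᶜ n = 1 := by
  have h0 : 0 < n := by omega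
  have h1 : 1 < n := by omega
  have h01 : (⟨1, h1⟩ : Fin n) ∈ (urrt ω n).neighborSet ⟨0, h0⟩ := by
    have := urrt_adj_attachment ω n 0 h1
    have h00 := (ω 0).isLt
    have e : (⟨ω 0, lt_trans (ω 0).isLt h1⟩ : Fin n) = ⟨0, h0⟩ := Fin.ext (by
      change ((ω 0 : Fin 1) : ℕ) = 0
      omega)
    rw [e] at this
    exact this
  have hz := zero_notMem_descendants one_pos ω
  rw [← ncard_fin_eq_countBelow]
  constructor
  · rintro ⟨_, h⟩
    obtain ⟨a, ha⟩ := Set.ncard_eq_one.1 h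
    have h2 : ∀ u (hu : u < n), (urrt ω n).Adj ⟨0, h0⟩ ⟨u, hu⟩ → u = 1 := by
      intro u hu hadj
      have e1 : (⟨1, h1⟩ : Fin n) ∈ ({a} : Set (Fin n)) := ha ▸ h01
      have e2 : (⟨u, hu⟩ : Fin n) ∈ ({a} : Set (Fin n)) := ha ▸ hadj
      exact congrArg Fin.val ((Set.mem_singleton_iff.1 e2).trans (Set.mem_singleton_iff.1 e1).symm)
    have h3 : ∀ u < n, 0 < u → u ∈ descendants 1 ω := by
      intro u
      induction u using Nat.strong_induction_on with
      | _ u ih =>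
        intro hu hpos
        obtain ⟨k, rfl⟩ : ∃ k, u = k + 1 := ⟨u - 1, by omega⟩
        rw [succ_mem_descendants_iff]
        rcases Nat.eq_zero_or_pos (ω k) with hk | hk
        · have := urrt_adj_attachment ω n k hu
          have e : (⟨ω k, lt_trans (ω k).isLt hu⟩ : Fin n) = ⟨0, h0⟩ := Fin.ext hk
          rw [e] at this
          exact Or.inl (h2 _ hu this)
        · exact Or.inr (ih _ (ω k).isLt (lt_trans (ω k).isLt hu) hk)
    refine Set.ncard_eq_one.2 ⟨⟨0, h0⟩, Set.eq_singleton_iff_unique_mem.2 ⟨hz, fun u hu => ?_⟩⟩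
    by_contra hne
    exact hu (h3 u u.isLt (Nat.pos_of_ne_zero fun e => hne (Fin.ext e)))
  · intro h
    obtain ⟨a, ha⟩ := Set.ncard_eq_one.1 h
    refine ⟨h0, Set.ncard_eq_one.2 ⟨⟨1, h1⟩, Set.eq_singleton_iff_unique_mem.2
      ⟨h01, fun u hu => ?_⟩⟩⟩
    have hadj : (urrt ω n).Adj ⟨0, h0⟩ u := hu
    have huD : (u : ℕ) ∈ descendants 1 ω := by
      by_contra hc
      have e1 : (⟨0, h0⟩ : Fin n) ∈ ({a} : Set (Fin n)) := ha ▸ hz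
      have e2 : u ∈ ({a} : Set (Fin n)) := ha ▸ hc
      exact hadj.ne ((Set.mem_singleton_iff.1 e1).trans (Set.mem_singleton_iff.1 e2).symm)
    exact Fin.ext (urrt_adj_boundary hadj.symm huD hz).1

/-- The progeny of `1` has `n - 1` elements, so the root has betweenness zero and every other vertex
precedes it. -/
theorem rootRank_eq_of_rootIsLeaf {n : ℕ} (hn : 2 ≤ n) {ω : Attachments}
    (h : RootIsLeaf n ω) : rootRank n ω = n := by
  classical
  rw [rootIsLeaf_iff hn] at h
  have h1 := countBelow_add_countBelow_compl (descendants 1 ω) n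
  have h2 := betweenness_root_le ω one_pos (by omega : 1 < n)
  have h3 : countBelow (descendants 1 ω) n = n - 1 := by omega
  rw [h3] at h2
  rw [rootRank_eq (by omega)]
  have : (Finset.range n).filter (BeatsRoot n ω) = (Finset.range n).erase 0 := by
    ext j
    rw [Finset.mem_filter, Finset.mem_erase, Finset.mem_range]
    constructor
    · rintro ⟨hj, -, h, -⟩
      exact ⟨h.ne', hj⟩
    · rintro ⟨hj, hjn⟩
      exact ⟨hjn, hjn, Nat.pos_of_ne_zero hj, le_trans (by omega) (Nat.zero_le _)⟩
  rw [this, Finset.card_erase_of_mem (Finset.mem_range.2 (by omega)), Finset.card_range]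
  omega

theorem integral_root_leaf (k : ℕ) :
    ∫ ω, (if countBelow (descendants 1 ω)ᶜ (k + 2) = 1 then (1 : ℝ) else 0) ∂urrtMeasure
      = 1 / (k + 1) := by
  rw [(inherited_descendants 1).compl.integral_comp_countBelow
    countBelow_compl_descendants_one_two k fun a => if a = 1 then (1 : ℝ) else 0]
  simp

theorem measureReal_rootIsLeaf {n : ℕ} (hn : 2 ≤ n) :
    urrtMeasure.real {ω | RootIsLeaf n ω} = 1 / ((n : ℝ) - 1) := by
  classical
  obtain ⟨k, rfl⟩ : ∃ k, n = k + 2 := ⟨n - 2, by omega⟩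
  simp only [rootIsLeaf_iff hn]
  rw [measureReal_eq_integral_ite (DependsOn.measurableSet_attachments (k := k + 1) ?_)]
  · rw [integral_root_leaf]
    push_cast
    congr 1
    ring
  · intro ω ω' h
    exact congrArg (· = 1) ((inherited_descendants 1).compl.dependsOn_countBelow (k + 1) h)

/-! ### The tail of the rank of the root -/

theorem one_le_mul_invSq {s x : ℕ} (hx : 3 ≤ x) (h : x ≤ 3 * s) :
    1 ≤ 9 * ((s : ℝ) * (s + 1) * invSq x) := by
  have h1 : (3 : ℝ) ≤ x := by exact_mod_cast hx
  have h2 : (x : ℝ) ≤ 3 * s := by exact_mod_cast h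
  have h3 : (0 : ℝ) < ((x : ℝ) - 1) * (x - 2) := mul_pos (by linarith) (by linarith)
  unfold invSq
  rw [mul_one_div, mul_div_assoc', le_div_iff₀ h3]
  nlinarith

/-- Being ahead of the root forces `3s` to be at least the smaller part, so one of the two summands
is already at least one. -/
theorem BeatsRoot.one_le {k j : ℕ} {ω : Attachments} (h : BeatsRoot (k + 1) ω j)
    (hA : 3 ≤ countBelow (descendants 1 ω) (k + 1))
    (hC : 3 ≤ countBelow (descendants 1 ω)ᶜ (k + 1)) :
    1 ≤ 9 * ((countBelow (descendants j ω) (k + 1) : ℝ) *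
        (countBelow (descendants j ω) (k + 1) + 1) * invSq (countBelow (descendants 1 ω) (k + 1)))
      + 9 * ((countBelow (descendants j ω) (k + 1) : ℝ) *
        (countBelow (descendants j ω) (k + 1) + 1) *
          invSq (countBelow (descendants 1 ω)ᶜ (k + 1))) := by
  obtain ⟨hj, hj0, hB⟩ := h
  have h1 := le_betweenness_root ω (Nat.zero_lt_of_lt hj)
  have h2 := betweenness_le_of_ne_root ω (⟨j, hj⟩ : Fin (k + 1))
  have h3 := countBelow_add_countBelow_compl (descendants 1 ω) (k + 1)
  have h4 := countBelow_add_countBelow_compl (descendants j ω) (k + 1)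
  simp only at h2
  set s := countBelow (descendants j ω) (k + 1)
  set r := countBelow (descendants j ω)ᶜ (k + 1)
  set a := countBelow (descendants 1 ω) (k + 1)
  set c := countBelow (descendants 1 ω)ᶜ (k + 1)
  have h5 := (Nat.add_le_add_right (h1.trans hB) (r ^ 2)).trans h2
  obtain ⟨d, hd⟩ : ∃ d, c = d + 1 := ⟨c - 1, by omega⟩
  have hk : k = a + d := by omega
  have hr : r + s = a + d + 1 := by omega
  rw [hd, Nat.add_sub_cancel, Nat.add_sub_cancel, hk] at h5
  -- From `2ad ≤ (a + d)² - r²` with `r = a + d + 1 - s`. It gives `min(a, d) ≤ 2s`; the constant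
  -- `3` below absorbs `c = d + 1`.
  have key : a * d ≤ (a + d) * s := by nlinarith
  have pa := mul_nonneg (by positivity : (0 : ℝ) ≤ s * (s + 1)) (invSq_nonneg hA)
  have pc := mul_nonneg (by positivity : (0 : ℝ) ≤ s * (s + 1)) (invSq_nonneg hC)
  rcases le_total a d with had | had
  · have : a ≤ 3 * s := by
      by_contra hcon
      nlinarith
    have := one_le_mul_invSq hA this
    linarith
  · have : c ≤ 3 * s := by
      by_contra hcon
      nlinarith
    have := one_le_mul_invSq hC this
    linarith

theorem integral_small_le {X : Attachments → Set ℕ} (hX : Inherited 1 X)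
    (h2 : ∀ ω, countBelow (X ω) 2 = 1) {q : ℕ} (hq : 1 ≤ q) :
    ∫ ω, (if countBelow (X ω) (q + 1) ≤ 2 then (1 : ℝ) else 0) ∂urrtMeasure ≤ 2 / q := by
  obtain ⟨r, rfl⟩ : ∃ r, q = r + 1 := ⟨q - 1, by omega⟩
  rw [hX.integral_comp_countBelow h2 r fun a => if a ≤ 2 then (1 : ℝ) else 0]
  push_cast
  gcongr
  rw [← Finset.sum_filter]
  have : (Finset.Icc 1 (r + 1)).filter (· ≤ 2) ⊆ Finset.Icc 1 2 := by
    intro a ha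
    simp only [Finset.mem_filter, Finset.mem_Icc] at ha ⊢
    omega
  have h3 := Finset.card_le_card this
  simp only [Nat.card_Icc] at h3
  rw [Finset.sum_const, nsmul_eq_mul, mul_one]
  exact_mod_cast h3

theorem sum_Ico_inv_mul_pred_le {q n : ℕ} (hq : 1 ≤ q) (hn : q + 1 ≤ n) :
    ∑ j ∈ Finset.Ico (q + 1) n, 1 / ((j : ℝ) * (j - 1)) ≤ 1 / q - 1 / (n - 1) := by
  induction n, hn using Nat.le_induction with
  | base => simp
  | succ n hn ih =>
    rw [Finset.sum_Ico_succ_top hn]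
    have : (2 : ℝ) ≤ n := by exact_mod_cast (by omega : 2 ≤ n)
    have h1 : (n : ℝ) - 1 ≠ 0 := by linarith
    have h2 : (n : ℝ) ≠ 0 := by linarith
    have : 1 / ((n : ℝ) * (n - 1)) = 1 / (n - 1) - 1 / ((n + 1 : ℕ) - 1) := by
      push_cast
      rw [show (n : ℝ) + 1 - 1 = n by ring]
      field_simp
      ring
    rw [this]
    linarith

/-- The terms whose sum over `j` controls the number of late vertices ranked before the root. -/
noncomputable def progenyRatio (q k j : ℕ) (X : Set ℕ) (ω : Attachments) : ℝ :=
  (if 3 ≤ countBelow X (q + 1) then (1 : ℝ) else 0)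
    * (((countBelow (descendants j ω) (k + 1) : ℝ) * (countBelow (descendants j ω) (k + 1) + 1))
      * invSq (countBelow X (k + 1)))

theorem progenyRatio_nonneg {q k : ℕ} (hk : q ≤ k) (j : ℕ) (X : Set ℕ) (ω : Attachments) :
    0 ≤ progenyRatio q k j X ω := by
  unfold progenyRatio
  split_ifs with h
  · have := invSq_nonneg (h.trans (countBelow_mono X (by omega : q + 1 ≤ k + 1)))
    positivity
  · simp

theorem integrable_progenyRatio {X : Attachments → Set ℕ} (hX : Inherited 1 X) {q k : ℕ}
    (hk : q ≤ k) (j : ℕ) : Integrable (fun ω => progenyRatio q k j (X ω) ω) urrtMeasure :=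
  DependsOn.integrable_attachments (k := k) fun ω ω' h => by
    have e1 : countBelow (X ω) (q + 1) = countBelow (X ω') (q + 1) :=
      (hX.dependsOn_countBelow q).mono (Set.Iio_subset_Iio hk) h
    have e2 : countBelow (X ω) (k + 1) = countBelow (X ω') (k + 1) := hX.dependsOn_countBelow k h
    have e3 : countBelow (descendants j ω) (k + 1) = countBelow (descendants j ω') (k + 1) :=
      (inherited_descendants j).dependsOn_countBelow k h
    simp only [progenyRatio, e1, e2, e3]

theorem integrable_small {X : Attachments → Set ℕ} (hX : Inherited 1 X) (q : ℕ) :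
    Integrable (fun ω => if countBelow (X ω) (q + 1) ≤ 2 then (1 : ℝ) else 0) urrtMeasure :=
  DependsOn.integrable_attachments (k := q) fun ω ω' h => by
    have e1 : countBelow (X ω) (q + 1) = countBelow (X ω') (q + 1) := hX.dependsOn_countBelow q h
    simp only [e1]

theorem sum_integral_progenyRatio_le {X : Attachments → Set ℕ} (hX : Inherited 1 X)
    (h2 : ∀ ω, countBelow (X ω) 2 = 1) {q k : ℕ} (hq : 2 ≤ q) (hk : q ≤ k) :
    ∑ j ∈ Finset.Ico (q + 1) (k + 1), ∫ ω, progenyRatio q k j (X ω) ω ∂urrtMeasure ≤ 2 := by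
  have hq' : (2 : ℝ) ≤ q := by exact_mod_cast hq
  calc _ ≤ ∑ j ∈ Finset.Ico (q + 1) (k + 1), 2 * ((q : ℝ) - 1) * (1 / ((j : ℝ) * (j - 1))) := by
        refine Finset.sum_le_sum fun j hj => ?_
        rw [Finset.mem_Ico] at hj
        refine (hX.integral_descendants_mul_invSq_le h2 hq (by omega : q ≤ j)
          (by omega : j ≤ k)).trans (le_of_eq ?_)
        ring
    _ = 2 * ((q : ℝ) - 1) * ∑ j ∈ Finset.Ico (q + 1) (k + 1), 1 / ((j : ℝ) * (j - 1)) := by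
        rw [Finset.mul_sum]
    _ ≤ 2 * ((q : ℝ) - 1) * (1 / q) := by
        refine mul_le_mul_of_nonneg_left ?_ (by linarith)
        refine (sum_Ico_inv_mul_pred_le (by omega) (by omega)).trans ?_
        have : (0 : ℝ) ≤ 1 / (((k + 1 : ℕ) : ℝ) - 1) := by
          push_cast
          rw [add_sub_cancel_right]
          positivity
        linarith
    _ ≤ 2 := by
        rw [mul_one_div, div_le_iff₀ (by linarith)]
        linarith

/-- Markov's inequality in pointwise form: the first `q + 1` vertices account for at most half of
`2(q + 1)`, so at least `q + 1` later ones precede the root, each contributing at least one to the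
sum unless a part is still small. -/
theorem indicator_rootRank_le {q k : ℕ} (hk : q ≤ k) (ω : Attachments) :
    (if 2 * (q + 1) < rootRank (k + 1) ω then (1 : ℝ) else 0)
      ≤ (if countBelow (descendants 1 ω) (q + 1) ≤ 2 then (1 : ℝ) else 0)
        + (if countBelow (descendants 1 ω)ᶜ (q + 1) ≤ 2 then (1 : ℝ) else 0)
        + (1 / (q + 1)) * ∑ j ∈ Finset.Ico (q + 1) (k + 1),
          (9 * progenyRatio q k j (descendants 1 ω) ω
            + 9 * progenyRatio q k j (descendants 1 ω)ᶜ ω) := by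
  classical
  have hnn : ∀ j, 0 ≤ 9 * progenyRatio q k j (descendants 1 ω) ω
      + 9 * progenyRatio q k j (descendants 1 ω)ᶜ ω := fun j => by
    have h1 := progenyRatio_nonneg hk j (descendants 1 ω) ω
    have h2 := progenyRatio_nonneg hk j (descendants 1 ω)ᶜ ω
    linarith
  have hsum := Finset.sum_nonneg (s := Finset.Ico (q + 1) (k + 1)) fun j _ => hnn j
  have hs : 0 ≤ (1 / ((q : ℝ) + 1)) * ∑ j ∈ Finset.Ico (q + 1) (k + 1),
      (9 * progenyRatio q k j (descendants 1 ω) ω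
        + 9 * progenyRatio q k j (descendants 1 ω)ᶜ ω) := mul_nonneg (by positivity) hsum
  by_cases hR : 2 * (q + 1) < rootRank (k + 1) ω
  swap
  · rw [if_neg hR]
    have : ∀ p : Prop, [Decidable p] → (0 : ℝ) ≤ if p then 1 else 0 := fun p _ => by
      split_ifs <;> norm_num
    have h1 := this (countBelow (descendants 1 ω) (q + 1) ≤ 2)
    have h2 := this (countBelow (descendants 1 ω)ᶜ (q + 1) ≤ 2)
    linarith
  rw [if_pos hR]
  by_cases hA : countBelow (descendants 1 ω) (q + 1) ≤ 2
  · rw [if_pos hA]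
    have : (0 : ℝ) ≤ if countBelow (descendants 1 ω)ᶜ (q + 1) ≤ 2 then 1 else 0 := by
      split_ifs <;> norm_num
    linarith
  by_cases hC : countBelow (descendants 1 ω)ᶜ (q + 1) ≤ 2
  · rw [if_pos hC, if_neg hA]
    linarith
  rw [if_neg hA, if_neg hC]
  have hA' : 3 ≤ countBelow (descendants 1 ω) (q + 1) := by omega
  have hC' : 3 ≤ countBelow (descendants 1 ω)ᶜ (q + 1) := by omega
  have hmono := fun X : Set ℕ => countBelow_mono X (by omega : q + 1 ≤ k + 1)
  rw [rootRank_eq (n := k + 1) (by omega)] at hR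
  have hcard : q + 1 ≤ ((Finset.Ico (q + 1) (k + 1)).filter (BeatsRoot (k + 1) ω)).card := by
    have hsub : (Finset.range (k + 1)).filter (BeatsRoot (k + 1) ω)
        ⊆ Finset.range (q + 1) ∪ (Finset.Ico (q + 1) (k + 1)).filter (BeatsRoot (k + 1) ω) := by
      intro j hj
      simp only [Finset.mem_filter, Finset.mem_range, Finset.mem_union, Finset.mem_Ico] at hj ⊢
      by_cases h : j < q + 1
      · exact Or.inl h
      · exact Or.inr ⟨⟨by omega, hj.1⟩, hj.2⟩
    have h1 := (Finset.card_le_card hsub).trans (Finset.card_union_le _ _)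
    rw [Finset.card_range] at h1
    omega
  have hge : ((q : ℝ) + 1) ≤ ∑ j ∈ Finset.Ico (q + 1) (k + 1),
      (9 * progenyRatio q k j (descendants 1 ω) ω
        + 9 * progenyRatio q k j (descendants 1 ω)ᶜ ω) := by
    calc ((q : ℝ) + 1)
        ≤ (((Finset.Ico (q + 1) (k + 1)).filter (BeatsRoot (k + 1) ω)).card : ℝ) := by
          exact_mod_cast hcard
      _ = ∑ j ∈ (Finset.Ico (q + 1) (k + 1)).filter (BeatsRoot (k + 1) ω), (1 : ℝ) := by simp
      _ ≤ ∑ j ∈ (Finset.Ico (q + 1) (k + 1)).filter (BeatsRoot (k + 1) ω),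
          (9 * progenyRatio q k j (descendants 1 ω) ω
            + 9 * progenyRatio q k j (descendants 1 ω)ᶜ ω) := by
          refine Finset.sum_le_sum fun j hj => ?_
          have := (Finset.mem_filter.1 hj).2.one_le (hA'.trans (hmono _)) (hC'.trans (hmono _))
          simpa only [progenyRatio, if_pos hA', if_pos hC', one_mul] using this
      _ ≤ _ := Finset.sum_le_sum_of_subset_of_nonneg (Finset.filter_subset _ _)
          fun j _ _ => hnn j
  rw [zero_add, zero_add, one_div_mul_eq_div, le_div_iff₀ (by positivity), one_mul]
  exact hge

theorem measureReal_two_mul_lt_rootRank_le {q k : ℕ} (hq : 2 ≤ q) (hk : q ≤ k) :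
    urrtMeasure.real {ω | 2 * (q + 1) < rootRank (k + 1) ω} ≤ 44 / (q + 1) := by
  have hA := inherited_descendants 1
  have hC := hA.compl
  have hA2 : ∀ ω, countBelow (descendants 1 ω) 2 = 1 := countBelow_descendants_self 1
  have hC2 := countBelow_compl_descendants_one_two
  have i1 := integrable_small hA q
  have i2 := integrable_small hC q
  have i3 : ∀ j ∈ Finset.Ico (q + 1) (k + 1), Integrable (fun ω =>
      9 * progenyRatio q k j (descendants 1 ω) ω
        + 9 * progenyRatio q k j (descendants 1 ω)ᶜ ω) urrtMeasure := fun j _ =>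
    ((integrable_progenyRatio hA hk j).const_mul 9).add
      ((integrable_progenyRatio hC hk j).const_mul 9)
  have i4 := (integrable_finsetSum _ i3).const_mul (1 / ((q : ℝ) + 1))
  have hmeas := measurableSet_rootRank (k + 1) fun r => 2 * (q + 1) < r
  rw [measureReal_eq_integral_ite hmeas]
  have i0 : Integrable (fun ω => if 2 * (q + 1) < rootRank (k + 1) ω then (1 : ℝ) else 0)
      urrtMeasure := DependsOn.integrable_attachments (k := k) fun ω ω' h => by
    simp only [rootRank_dependsOn (k + 1) h]
  refine (integral_mono i0 ((i1.add i2).add i4) fun ω => indicator_rootRank_le hk ω).trans ?_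
  have e : ∀ j ∈ Finset.Ico (q + 1) (k + 1), ∫ ω, (9 * progenyRatio q k j (descendants 1 ω) ω
        + 9 * progenyRatio q k j (descendants 1 ω)ᶜ ω) ∂urrtMeasure
      = 9 * ∫ ω, progenyRatio q k j (descendants 1 ω) ω ∂urrtMeasure
        + 9 * ∫ ω, progenyRatio q k j (descendants 1 ω)ᶜ ω ∂urrtMeasure := fun j _ => by
    rw [integral_add ((integrable_progenyRatio hA hk j).const_mul 9)
      ((integrable_progenyRatio hC hk j).const_mul 9), integral_const_mul, integral_const_mul]
  have s1 := sum_integral_progenyRatio_le hA hA2 hq hk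
  have s2 := sum_integral_progenyRatio_le hC hC2 hq hk
  have b1 := integral_small_le hA hA2 (by omega : 1 ≤ q)
  have b2 := integral_small_le hC hC2 (by omega : 1 ≤ q)
  have hq' : (2 : ℝ) ≤ q := by exact_mod_cast hq
  rw [integral_add' (i1.add i2) i4, integral_add' i1 i2, integral_const_mul,
    integral_finsetSum _ i3, Finset.sum_congr rfl e, Finset.sum_add_distrib, ← Finset.mul_sum,
    ← Finset.mul_sum]
  have b3 : (2 : ℝ) / q ≤ 4 / (q + 1) := by
    rw [div_le_div_iff₀ (by linarith) (by linarith)]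
    linarith
  have b4 : 1 / ((q : ℝ) + 1) * (9 * ∑ j ∈ Finset.Ico (q + 1) (k + 1),
        ∫ ω, progenyRatio q k j (descendants 1 ω) ω ∂urrtMeasure
      + 9 * ∑ j ∈ Finset.Ico (q + 1) (k + 1),
        ∫ ω, progenyRatio q k j (descendants 1 ω)ᶜ ω ∂urrtMeasure) ≤ 1 / ((q : ℝ) + 1) * 36 :=
    mul_le_mul_of_nonneg_left (by linarith) (by positivity)
  -- Each part is small with probability at most `2/q ≤ 4/(q + 1)`, and `36 = 9 * 2 + 9 * 2` comes
  -- from the two progeny sums.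
  have b5 : (44 : ℝ) / (q + 1) = 4 / (q + 1) + 4 / (q + 1) + 1 / (q + 1) * 36 := by ring
  rw [b5]
  linarith

theorem exists_rootRank_tail_bound : ∃ c : ℝ, 0 < c ∧ ∀ n : ℕ, 1 ≤ n → ∀ x : ℕ, 1 ≤ x → x ≤ n →
    urrtMeasure.real {ω | x < rootRank n ω} ≤ c / x := by
  -- `176 = 44 * 4`, because `x ≤ 2(q + 1) + 1 ≤ 4(q + 1)` when `q + 1 = x / 2`; for `x < 6` the
  -- bound exceeds one.
  refine ⟨176, by norm_num, fun n hn x hx hxn => ?_⟩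
  have hx0 : (0 : ℝ) < x := by exact_mod_cast hx
  by_cases h : x < 6
  · refine (measureReal_le_one).trans ?_
    rw [le_div_iff₀ hx0]
    have : (x : ℝ) < 6 := by exact_mod_cast h
    linarith
  · obtain ⟨q, hq⟩ : ∃ q, x / 2 = q + 1 := ⟨x / 2 - 1, by omega⟩
    obtain ⟨k, rfl⟩ : ∃ k, n = k + 1 := ⟨n - 1, by omega⟩
    have h1 := measureReal_two_mul_lt_rootRank_le (by omega : 2 ≤ q) (by omega : q ≤ k)
    have h2 : {ω | x < rootRank (k + 1) ω} ⊆ {ω | 2 * (q + 1) < rootRank (k + 1) ω} :=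
      fun ω hω => by
        have hω : x < rootRank (k + 1) ω := hω
        change 2 * (q + 1) < rootRank (k + 1) ω
        omega
    refine (measureReal_mono h2).trans (h1.trans ?_)
    rw [div_le_div_iff₀ (by positivity) hx0]
    have : (x : ℝ) ≤ 2 * (q + 1) + 1 := by exact_mod_cast (by omega : x ≤ 2 * (q + 1) + 1)
    nlinarith

/-! ### The expected rank of the root -/

/-- With `d = c - 1` and `t = s - 1`, the root has betweenness at most `d(2a + d)`, and `j` has at
least `2t(n - s)`. Here `2d ≤ t` and `n ≤ 2(n - s)` suffice. -/
theorem beatsRoot_of_le {k j : ℕ} {ω : Attachments} (hj0 : 0 < j) (hj : j ≤ k) (hk : 1 ≤ k)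
    (h : 2 * (countBelow (descendants 1 ω)ᶜ (k + 1) - 1)
      ≤ countBelow (descendants j ω) (k + 1) - 1)
    (hs : 2 * countBelow (descendants j ω) (k + 1) ≤ k + 1) : BeatsRoot (k + 1) ω j := by
  have hjk : j < k + 1 := by omega
  refine ⟨hjk, hj0, ?_⟩
  have h1 := betweenness_root_le ω one_pos (by omega : 1 < k + 1)
  have h2 := le_betweenness ω (⟨j, hjk⟩ : Fin (k + 1))
  have h3 := countBelow_add_countBelow_compl (descendants 1 ω) (k + 1)
  have h4 := countBelow_add_countBelow_compl (descendants j ω) (k + 1)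
  have h5 := one_le_countBelow_descendants hjk ω
  have h6 : 1 ≤ countBelow (descendants 1 ω)ᶜ (k + 1) :=
    (countBelow_compl_descendants_one_two ω).symm.le.trans (countBelow_mono _ (by omega))
  simp only at h2
  set s := countBelow (descendants j ω) (k + 1)
  set r := countBelow (descendants j ω)ᶜ (k + 1)
  set a := countBelow (descendants 1 ω) (k + 1)
  set c := countBelow (descendants 1 ω)ᶜ (k + 1)
  refine le_trans ?_ h2
  obtain ⟨d, hd⟩ : ∃ d, c = d + 1 := ⟨c - 1, by omega⟩
  obtain ⟨t, ht⟩ : ∃ t, s = t + 1 := ⟨s - 1, by omega⟩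
  have hka : k = a + d := by omega
  have hk2 : k ^ 2 = (a + d) ^ 2 := by rw [hka]
  rw [Nat.add_sub_cancel, hk2] at h1
  rw [ht, Nat.add_sub_cancel]
  have hdt : 2 * d ≤ t := by omega
  have hr : a + d + 1 ≤ 2 * r := by omega
  have e1 : 2 * d * (2 * a + d) ≤ t * (2 * a + d) := Nat.mul_le_mul_right _ hdt
  have e2 : t * (a + d + 1) ≤ t * (2 * r) := Nat.mul_le_mul_left _ hr
  nlinarith

open Classical in
-- Of the `M + 1` splittings of `M`, exactly those with first part at most `M / 3` satisfy the
-- condition: at least a third of them.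
theorem sum_antidiagonal_indicator_sub_third_nonneg (M : ℕ) :
    0 ≤ ∑ p ∈ Finset.HasAntidiagonal.antidiagonal M,
      ((if 2 * (p.1 + 1 - 1) ≤ p.2 + 1 - 1 then (1 : ℝ) else 0) - 1 / 3) := by
  rw [Finset.Nat.sum_antidiagonal_eq_sum_range_succ_mk, Finset.sum_sub_distrib]
  have h1 : ((M / 3 + 1 : ℕ) : ℝ) ≤ ∑ i ∈ Finset.range M.succ,
      (if 2 * (i + 1 - 1) ≤ M - i + 1 - 1 then (1 : ℝ) else 0) := by
    rw [← Finset.sum_filter, Finset.sum_const, nsmul_eq_mul, mul_one]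
    have hsub : Finset.range (M / 3 + 1)
        ⊆ (Finset.range M.succ).filter fun i => 2 * (i + 1 - 1) ≤ M - i + 1 - 1 := by
      intro i hi
      rw [Finset.mem_range] at hi
      rw [Finset.mem_filter, Finset.mem_range]
      omega
    have h2 := Finset.card_le_card hsub
    rw [Finset.card_range] at h2
    exact_mod_cast h2
  have h3 : (M : ℝ) + 1 ≤ 3 * ((M / 3 + 1 : ℕ) : ℝ) := by
    exact_mod_cast (by omega : M + 1 ≤ 3 * (M / 3 + 1))
  have h4 : ∑ _i ∈ Finset.range M.succ, (1 / 3 : ℝ) = (M + 1) / 3 := by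
    rw [Finset.sum_const, Finset.card_range, nsmul_eq_mul]
    push_cast
    ring
  rw [h4]
  linarith

/-- The indicator of the event that the root is a leaf of `T_{j + 1}`. -/
noncomputable def leafIndicator (j : ℕ) (ω : Attachments) : ℝ :=
  if countBelow (descendants 1 ω)ᶜ (j + 1) = 1 then 1 else 0

theorem leafIndicator_dependsOn (j : ℕ) : DependsOn (leafIndicator j) (Set.Iio j) := by
  intro ω ω' h
  have e : countBelow (descendants 1 ω)ᶜ (j + 1) = countBelow (descendants 1 ω')ᶜ (j + 1) :=
    (inherited_descendants 1).compl.dependsOn_countBelow j h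
  simp only [leafIndicator, e]

theorem leafIndicator_nonneg (j : ℕ) (ω : Attachments) : 0 ≤ leafIndicator j ω := by
  unfold leafIndicator
  split_ifs <;> norm_num

theorem integral_leafIndicator {j : ℕ} (hj : 1 ≤ j) :
    ∫ ω, leafIndicator j ω ∂urrtMeasure = 1 / j := by
  obtain ⟨i, rfl⟩ : ∃ i, j = i + 1 := ⟨j - 1, by omega⟩
  have := integral_root_leaf i
  simp only [leafIndicator]
  rw [this]
  push_cast
  rfl

theorem leafIndicator_mul_ite_dependsOn {j k : ℕ} (hk : j ≤ k) :
    DependsOn (fun ω => leafIndicator j ω * (if 2 * (countBelow (descendants 1 ω)ᶜ (k + 1) - 1)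
        ≤ countBelow (descendants j ω) (k + 1) - 1 then (1 : ℝ) else 0)) (Set.Iio k) := by
  intro ω ω' h
  have e1 := (leafIndicator_dependsOn j).mono (Set.Iio_subset_Iio hk) h
  have e2 : countBelow (descendants 1 ω)ᶜ (k + 1) = countBelow (descendants 1 ω')ᶜ (k + 1) :=
    (inherited_descendants 1).compl.dependsOn_countBelow k h
  have e3 : countBelow (descendants j ω) (k + 1) = countBelow (descendants j ω') (k + 1) :=
    (inherited_descendants j).dependsOn_countBelow k h
  simp only [e1, e2, e3]

theorem third_integral_leafIndicator_le {j k : ℕ} (hj : 1 ≤ j) (hk : j ≤ k) :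
    1 / 3 * ∫ ω, leafIndicator j ω ∂urrtMeasure
      ≤ ∫ ω, leafIndicator j ω * (if 2 * (countBelow (descendants 1 ω)ᶜ (k + 1) - 1)
        ≤ countBelow (descendants j ω) (k + 1) - 1 then (1 : ℝ) else 0) ∂urrtMeasure := by
  have hC := (inherited_descendants 1).compl.mono hj
  have hS := inherited_descendants j
  have hleaf : ∀ ω, leafIndicator j ω ≠ 0 → countBelow (descendants 1 ω)ᶜ (j + 1) = 1 := by
    intro ω h
    by_contra hne
    exact h (if_neg hne)
  have h := integral_nonneg_of_sum_antidiagonal_nonneg hj hC hS (leafIndicator_dependsOn j)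
    (leafIndicator_nonneg j) hleaf (fun ω _ => countBelow_descendants_self j ω)
    (fun ω h u hu => by
      -- When the root is a leaf of `T_{j + 1}`, its part consists of `0` alone, so `j` and hence
      -- all its progeny lie outside.
      rw [hC.mem_iff_of_mem_descendants le_rfl hu]
      intro hjC
      classical
      have h1 := hleaf ω h
      rw [countBelow_succ, if_pos hjC] at h1
      have h2 : countBelow (descendants 1 ω)ᶜ 1 ≤ countBelow (descendants 1 ω)ᶜ j :=
        countBelow_mono _ hj
      have h3 : countBelow (descendants 1 ω)ᶜ (0 + 1) = 0 + 1 := by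
        rw [countBelow_succ, if_pos (show 0 ∈ (descendants 1 ω)ᶜ from
          zero_notMem_descendants one_pos ω)]
        simp [countBelow]
      rw [zero_add] at h3
      omega) hk
    (fun c s => (if 2 * (c - 1) ≤ s - 1 then (1 : ℝ) else 0) - 1 / 3)
    (fun M _ => by
      classical
      convert sum_antidiagonal_indicator_sub_third_nonneg M)
  simp only [mul_sub] at h
  rw [integral_sub (leafIndicator_mul_ite_dependsOn hk).integrable_attachments
    ((leafIndicator_dependsOn j).integrable_attachments.mul_const _), integral_mul_const] at h
  linarith

/-- A random variable bounded above by the indicator of `BeatsRoot (k + 1) ω j`. -/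
noncomputable def beatsMinorant (k j : ℕ) (ω : Attachments) : ℝ :=
  leafIndicator j ω * (if 2 * (countBelow (descendants 1 ω)ᶜ (k + 1) - 1)
        ≤ countBelow (descendants j ω) (k + 1) - 1 then (1 : ℝ) else 0)
    - leafIndicator j ω * (countBelow (descendants j ω) (k + 1) : ℝ) * (2 / (k + 1))

open Classical in
-- The subtracted term is at least one whenever the root was a leaf and the progeny of `j` exceeds
-- half of the tree; this replaces the side condition of `beatsRoot_of_le` by a first moment.
theorem beatsMinorant_le {k j : ℕ} (hj : 1 ≤ j) (hk : j ≤ k) (ω : Attachments) :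
    beatsMinorant k j ω ≤ if BeatsRoot (k + 1) ω j then 1 else 0 := by
  have hk0 : (0 : ℝ) < k + 1 := by positivity
  have hr : (0 : ℝ) ≤ if BeatsRoot (k + 1) ω j then 1 else 0 := by split_ifs <;> norm_num
  unfold beatsMinorant leafIndicator
  by_cases hL : countBelow (descendants 1 ω)ᶜ (j + 1) = 1
  swap
  · simpa [if_neg hL] using hr
  rw [if_pos hL, one_mul, one_mul]
  have hs0 : (0 : ℝ) ≤ countBelow (descendants j ω) (k + 1) * (2 / (k + 1)) := by positivity
  by_cases h : 2 * (countBelow (descendants 1 ω)ᶜ (k + 1) - 1)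
      ≤ countBelow (descendants j ω) (k + 1) - 1
  swap
  · rw [if_neg h]
    linarith
  rw [if_pos h]
  by_cases hs : 2 * countBelow (descendants j ω) (k + 1) ≤ k + 1
  · rw [if_pos (beatsRoot_of_le hj hk (hj.trans hk) h hs)]
    linarith
  · have : (1 : ℝ) ≤ countBelow (descendants j ω) (k + 1) * (2 / (k + 1)) := by
      rw [mul_div_assoc', le_div_iff₀ hk0, one_mul]
      have : (k : ℝ) + 1 ≤ 2 * countBelow (descendants j ω) (k + 1) := by
        exact_mod_cast (not_le.1 hs).le
      linarith
    linarith

theorem leafIndicator_mul_dependsOn {j k : ℕ} (hk : j ≤ k) :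
    DependsOn (fun ω => leafIndicator j ω * (countBelow (descendants j ω) (k + 1) : ℝ))
      (Set.Iio k) := by
  intro ω ω' h
  have e1 := (leafIndicator_dependsOn j).mono (Set.Iio_subset_Iio hk) h
  have e3 : countBelow (descendants j ω) (k + 1) = countBelow (descendants j ω') (k + 1) :=
    (inherited_descendants j).dependsOn_countBelow k h
  simp only [e1, e3]

theorem integrable_beatsMinorant {j k : ℕ} (hk : j ≤ k) :
    Integrable (beatsMinorant k j) urrtMeasure :=
  (leafIndicator_mul_ite_dependsOn hk).integrable_attachments.sub
    ((leafIndicator_mul_dependsOn hk).integrable_attachments.mul_const _)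

/-- The mean is at least `(1/3 - 2/(j + 1)) / j`, and `j ≥ 7` makes the bracket at least `1/3 - 1/4
= 1/12`. -/
theorem le_integral_beatsMinorant {j k : ℕ} (hj : 7 ≤ j) (hk : j ≤ k) :
    1 / 12 * (1 / (j : ℝ)) ≤ ∫ ω, beatsMinorant k j ω ∂urrtMeasure := by
  unfold beatsMinorant
  rw [integral_sub (leafIndicator_mul_ite_dependsOn hk).integrable_attachments
    ((leafIndicator_mul_dependsOn hk).integrable_attachments.mul_const _), integral_mul_const,
    integral_mul_countBelow (inherited_descendants j) (leafIndicator_dependsOn j)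
      (countBelow_descendants_self j) hk]
  have h1 := third_integral_leafIndicator_le (by omega : 1 ≤ j) hk
  rw [integral_leafIndicator (by omega)] at h1 ⊢
  have hj' : (7 : ℝ) ≤ j := by exact_mod_cast hj
  have hk0 : (k : ℝ) + 1 ≠ 0 := by positivity
  have e : ((k : ℝ) + 1) / (j + 1) * (1 / j) * (2 / (k + 1)) = 2 / (j + 1) * (1 / j) := by
    field_simp
  rw [e]
  have h2 : (2 : ℝ) / (j + 1) ≤ 1 / 4 := by
    rw [div_le_div_iff₀ (by linarith) (by norm_num)]
    linarith
  have h3 : (0 : ℝ) ≤ 1 / j := by positivity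
  have h4 := mul_le_mul_of_nonneg_right h2 h3
  linarith

theorem le_integral_rootRank (k : ℕ) :
    1 / 12 * ∑ j ∈ Finset.Ico 7 (k + 1), 1 / (j : ℝ)
      ≤ ∫ ω, (rootRank (k + 1) ω : ℝ) ∂urrtMeasure := by
  classical
  have hint : ∀ j ∈ Finset.Ico 7 (k + 1), Integrable (beatsMinorant k j) urrtMeasure :=
    fun j hj => integrable_beatsMinorant (Nat.lt_succ_iff.1 (Finset.mem_Ico.1 hj).2)
  calc _ = ∑ j ∈ Finset.Ico 7 (k + 1), 1 / 12 * (1 / (j : ℝ)) := Finset.mul_sum _ _ _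
    _ ≤ ∑ j ∈ Finset.Ico 7 (k + 1), ∫ ω, beatsMinorant k j ω ∂urrtMeasure :=
        Finset.sum_le_sum fun j hj => by
          rw [Finset.mem_Ico] at hj
          exact le_integral_beatsMinorant hj.1 (by omega)
    _ = ∫ ω, ∑ j ∈ Finset.Ico 7 (k + 1), beatsMinorant k j ω ∂urrtMeasure :=
        (integral_finsetSum _ hint).symm
    _ ≤ _ := by
        refine integral_mono (integrable_finsetSum _ hint) (integrable_rootRank _) fun ω => ?_
        beta_reduce
        rw [rootRank_eq (n := k + 1) (by omega)]
        calc _ ≤ ∑ j ∈ Finset.Ico 7 (k + 1), (if BeatsRoot (k + 1) ω j then (1 : ℝ) else 0) :=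
              Finset.sum_le_sum fun j hj => by
                rw [Finset.mem_Ico] at hj
                exact beatsMinorant_le (by omega) (by omega) ω
          _ = ((Finset.Ico 7 (k + 1)).filter (BeatsRoot (k + 1) ω)).card := by
              rw [← Finset.sum_filter]
              simp
          _ ≤ _ := by
              have hsub : (Finset.Ico 7 (k + 1)).filter (BeatsRoot (k + 1) ω)
                  ⊆ (Finset.range (k + 1)).filter (BeatsRoot (k + 1) ω) :=
                Finset.filter_subset_filter _ fun j hj => by
                  rw [Finset.mem_Ico] at hj
                  exact Finset.mem_range.2 hj.2
              have := Finset.card_le_card hsub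
              exact_mod_cast this.trans (Nat.le_add_left _ _)

theorem integral_rootRank_eq_sum (n : ℕ) :
    ∫ ω, (rootRank n ω : ℝ) ∂urrtMeasure
      = ∑ x ∈ Finset.range n, urrtMeasure.real {ω | x < rootRank n ω} := by
  have hint : ∀ x ∈ Finset.range n,
      Integrable (fun ω => if x < rootRank n ω then (1 : ℝ) else 0) urrtMeasure := fun x _ =>
    DependsOn.integrable_attachments (k := n - 1) fun ω ω' h => by
      simp only [rootRank_dependsOn n h]
  have e : ∀ x ∈ Finset.range n, urrtMeasure.real {ω | x < rootRank n ω}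
      = ∫ ω, (if x < rootRank n ω then (1 : ℝ) else 0) ∂urrtMeasure := fun x _ =>
    measureReal_eq_integral_ite (measurableSet_rootRank n fun r => x < r)
  rw [Finset.sum_congr rfl e, ← integral_finsetSum _ hint]
  refine integral_congr_ae (ae_of_all _ fun ω => ?_)
  beta_reduce
  rw [← Finset.sum_filter, Finset.sum_const, nsmul_eq_mul, mul_one]
  have : (Finset.range n).filter (fun x => x < rootRank n ω) = Finset.range (rootRank n ω) := by
    ext x
    have := rootRank_le n ω
    simp only [Finset.mem_filter, Finset.mem_range]
    omega
  rw [this, Finset.card_range]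

theorem sum_range_inv_le_log {n : ℕ} :
    ∑ x ∈ Finset.range n, 1 / ((x : ℝ) + 1) ≤ 1 + Real.log n := by
  have h := harmonic_le_one_add_log n
  simp only [harmonic, Rat.cast_sum] at h
  refine le_trans (le_of_eq (Finset.sum_congr rfl fun x _ => ?_)) h
  push_cast
  rw [one_div]

theorem log_le_sum_range_inv {n : ℕ} :
    Real.log (n + 1) ≤ ∑ x ∈ Finset.range n, 1 / ((x : ℝ) + 1) := by
  have h := log_add_one_le_harmonic n
  simp only [harmonic, Rat.cast_sum] at h
  push_cast at h
  refine h.trans (le_of_eq (Finset.sum_congr rfl fun x _ => ?_))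
  rw [one_div]

theorem integral_rootRank_isTheta_log :
    (fun n : ℕ => ∫ ω, (rootRank n ω : ℝ) ∂urrtMeasure) =Θ[atTop] fun n : ℕ => Real.log n := by
  have hlog : Tendsto (fun n : ℕ => Real.log n) atTop atTop :=
    Real.tendsto_log_atTop.comp tendsto_natCast_atTop_atTop
  have hnonneg : ∀ n, 0 ≤ ∫ ω, (rootRank n ω : ℝ) ∂urrtMeasure := fun n =>
    integral_nonneg fun ω => Nat.cast_nonneg _
  constructor
  · obtain ⟨c, hc, hb⟩ := exists_rootRank_tail_bound
    refine IsBigO.of_bound (1 + 2 * c) ?_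
    filter_upwards [hlog.eventually_ge_atTop 1, eventually_ge_atTop 1] with n hn hn1
    rw [Real.norm_of_nonneg (hnonneg n), Real.norm_of_nonneg (by linarith),
      integral_rootRank_eq_sum]
    obtain ⟨k, rfl⟩ : ∃ k, n = k + 1 := ⟨n - 1, by omega⟩
    rw [Finset.sum_range_succ']
    have h1 : ∑ x ∈ Finset.range k, urrtMeasure.real {ω | x + 1 < rootRank (k + 1) ω}
        ≤ c * (1 + Real.log ((k + 1 : ℕ) : ℝ)) := by
      calc _ ≤ ∑ x ∈ Finset.range k, c * (1 / ((x : ℝ) + 1)) :=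
            Finset.sum_le_sum fun x hx => by
              rw [Finset.mem_range] at hx
              refine (hb (k + 1) hn1 (x + 1) (by omega) (by omega)).trans (le_of_eq ?_)
              push_cast
              ring
        _ ≤ ∑ x ∈ Finset.range (k + 1), c * (1 / ((x : ℝ) + 1)) :=
            Finset.sum_le_sum_of_subset_of_nonneg
              (Finset.range_subset_range.2 (Nat.le_succ k)) fun x _ _ => by positivity
        _ = c * ∑ x ∈ Finset.range (k + 1), 1 / ((x : ℝ) + 1) := (Finset.mul_sum _ _ _).symm
        _ ≤ _ := mul_le_mul_of_nonneg_left sum_range_inv_le_log hc.le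
    have h2 : urrtMeasure.real {ω | 0 < rootRank (k + 1) ω} ≤ 1 := measureReal_le_one
    nlinarith
  -- `log n` is at most `D` plus twelve times the mean, where `D` is the part of the harmonic sum
  -- below `7`; once `log n ≥ 2D`, absorbing `D` doubles the constant.
  · refine IsBigO.of_bound 24 ?_
    set D := ∑ x ∈ Finset.range 6, 1 / ((x : ℝ) + 1) with hD
    filter_upwards [hlog.eventually_ge_atTop (2 * D), eventually_ge_atTop 7] with n hn hn7
    have hD0 : 0 ≤ D := Finset.sum_nonneg fun x _ => by positivity
    rw [Real.norm_of_nonneg (hnonneg n), Real.norm_of_nonneg (by linarith)]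
    obtain ⟨k, rfl⟩ : ∃ k, n = k + 1 := ⟨n - 1, by omega⟩
    have h1 := le_integral_rootRank k
    have h2 : D + ∑ j ∈ Finset.Ico 7 (k + 1), 1 / (j : ℝ)
        = ∑ x ∈ Finset.range k, 1 / ((x : ℝ) + 1) := by
      rw [hD, Finset.range_eq_Ico, Finset.range_eq_Ico,
        ← Finset.sum_Ico_consecutive _ (Nat.zero_le 6) (by omega : 6 ≤ k),
        ← Finset.sum_Ico_add' (fun j : ℕ => 1 / (j : ℝ)) 6 k 1]
      push_cast
      rfl
    have h3 := log_le_sum_range_inv (n := k)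
    have h4 : ((k + 1 : ℕ) : ℝ) = k + 1 := by push_cast; rfl
    rw [h4] at hn ⊢
    have h5 := h3.trans h2.ge
    clear_value D
    generalize ∑ j ∈ Finset.Ico 7 (k + 1), 1 / (j : ℝ) = S at h1 h5
    linarith

/-! ### The main theorem -/

theorem one_sub_le_of_tail {n x : ℕ} {c ε : ℝ}
    (hb : x ≤ n → urrtMeasure.real {ω | x < rootRank n ω} ≤ c / x) (hε : 0 ≤ ε)
    (h : c / x ≤ ε) : 1 - ε ≤ urrtMeasure.real {ω | rootRank n ω ≤ x} := by
  have hm := measurableSet_rootRank n fun r => r ≤ x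
  have h1 := probReal_compl_eq_one_sub (μ := urrtMeasure) hm
  have h2 : {ω | rootRank n ω ≤ x}ᶜ = {ω | x < rootRank n ω} := by
    ext ω
    change ¬ rootRank n ω ≤ x ↔ x < rootRank n ω
    exact not_le
  rw [h2] at h1
  -- The tail bound is available only for `x ≤ n`; beyond that the event is empty.
  rcases le_or_gt x n with hx | hx
  · have := hb hx
    linarith
  · have h3 : {ω | x < rootRank n ω} = ∅ :=
      Set.eq_empty_of_forall_notMem fun ω hω => by
        have h4 : x < rootRank n ω := hω
        have := rootRank_le n ω
        omega
    rw [h3, measureReal_empty] at h1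
    linarith

theorem setOf_rootRank_le_subset_rootInTop {n x : ℕ} {K : ℝ} (hn : 0 < n) (hx : (x : ℝ) ≤ K) :
    {ω | rootRank n ω ≤ x} ⊆ rootInTop n K := by
  intro ω hω
  have h : rootRank n ω ≤ x := hω
  rw [rootRank, dif_pos hn] at h
  refine ⟨hn, ?_⟩
  change (betweennessRank ω n ⟨0, hn⟩ : ℝ) ≤ K
  exact le_trans (by exact_mod_cast h) hx

theorem mainTheorem5 :
    -- tail bound for the rank of the root
    (∃ c : ℝ, 0 < c ∧ ∀ n : ℕ, 1 ≤ n → ∀ x : ℕ, 1 ≤ x → x ≤ n →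
      urrtMeasure.real {ω | x < rootRank n ω} ≤ c / x) ∧
    -- tightness
    (∀ ε : ℝ, 0 < ε → ∃ K : ℕ, 0 < K ∧ ∀ n : ℕ, 1 ≤ n →
      1 - ε ≤ urrtMeasure.real {ω | rootRank n ω ≤ K}) ∧
    -- confidence set
    (∃ C : ℝ, 0 < C ∧ ∀ ε : ℝ, 0 < ε →
      1 - ε ≤ liminf (fun n : ℕ => urrtMeasure.real (rootInTop n (C / ε))) atTop) ∧
    -- expected rank of the root
    (∀ n : ℕ, Integrable (fun ω => (rootRank n ω : ℝ)) urrtMeasure) ∧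
    ((fun n : ℕ => ∫ ω, (rootRank n ω : ℝ) ∂urrtMeasure) =Θ[atTop]
      fun n : ℕ => Real.log n) ∧
    -- the root is a leaf with probability `1 / (n - 1)`, and then it is ranked last
    (∀ n : ℕ, 2 ≤ n →
      urrtMeasure.real {ω | RootIsLeaf n ω} = 1 / ((n : ℝ) - 1) ∧
      ∀ ω : Attachments, RootIsLeaf n ω → rootRank n ω = n) := by
  refine ⟨exists_rootRank_tail_bound, fun ε hε => ?_, ?_, integrable_rootRank,
    integral_rootRank_isTheta_log, fun n hn =>
      ⟨measureReal_rootIsLeaf hn, fun ω h => rootRank_eq_of_rootIsLeaf hn h⟩⟩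
  · obtain ⟨c, hc, hb⟩ := exists_rootRank_tail_bound
    obtain ⟨K, hK⟩ := exists_nat_gt (c / ε)
    have hK0 : (0 : ℝ) < K := (div_pos hc hε).trans hK
    have hK1 : 0 < K := by exact_mod_cast hK0
    refine ⟨K, hK1, fun n hn => one_sub_le_of_tail (hb n hn K hK1) hε.le ?_⟩
    rw [div_le_iff₀ hK0]
    rw [div_lt_iff₀ hε] at hK
    linarith
  · obtain ⟨c, hc, hb⟩ := exists_rootRank_tail_bound
    -- For `ε < 1` the summand `2` forces the floor `x` of `K` to exceed one, so `K < x + 1 < 2x`,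
    -- and the factor `2` on `c` then gives `c / x ≤ ε`.
    refine ⟨2 * c + 2, by linarith, fun ε hε => ?_⟩
    have hcob : IsCoboundedUnder (· ≥ ·) atTop
        fun n : ℕ => urrtMeasure.real (rootInTop n ((2 * c + 2) / ε)) :=
      IsBoundedUnder.isCoboundedUnder_ge ⟨1, by simp⟩
    refine le_liminf_of_le hcob ?_
    filter_upwards [eventually_ge_atTop 1] with n hn
    rcases le_or_gt 1 ε with h1 | h1
    · exact le_trans (by linarith) measureReal_nonneg
    · set x := ⌊(2 * c + 2) / ε⌋₊ with hx
      have h2 : 2 * c + 2 ≤ (2 * c + 2) / ε := by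
        rw [le_div_iff₀ hε]
        nlinarith
      have h3 : (x : ℝ) ≤ (2 * c + 2) / ε := Nat.floor_le (by linarith)
      have h4 : (2 * c + 2) / ε < x + 1 := Nat.lt_floor_add_one _
      have h5 : (1 : ℝ) < x := by linarith
      have h6 : c / x ≤ ε := by
        rw [div_le_iff₀ (by linarith)]
        rw [div_lt_iff₀ hε] at h4
        nlinarith
      have h7 : 1 ≤ x := by exact_mod_cast h5.le
      exact (one_sub_le_of_tail (hb n hn x h7) hε.le h6).trans
        (measureReal_mono (setOf_rootRank_le_subset_rootInTop hn h3))
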